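/- All Banach lattices are real and all operators are continuous and linear. The norm of a Banach lattice $G$ is called order continuous if $\|x_\alpha\|\to 0$ for every net with $x_\alpha\downarrow 0$ in $G$. A subset $A$ of a Banach lattice $F$ is L-weakly compact if it is norm bounded and every disjoint sequence in its solid hull $\{y\in F : |y|\le |a| \text{ for some } a\in A\}$ converges to $0$ in norm. An operator $T:E\to F$ is almost L-weakly compact if it maps every relatively weakly compact subset of $E$ onto an L-weakly compact subset of $F$; it is semi-compact if for each $\varepsilon>0$ there is $u\in F$, $u\ge 0$, with $T(B_E)\subseteq[-u,u]+\varepsilon B_F$, where $B_E,B_F$ are the closed unit balls. **Theorem 4.** Let $E$ and $F$ be Banach lattices such that the norm of $F$ is order continuous. Then the following assertions are equivalent: 1. Every positive almost L-weakly compact operator $T:E\to F$ is semi-compact. 2. The norm of the dual Banach lattice $E'$ is order continuous, or $E$ is finite-dimensional, or $F$ is finite-dimensional. -/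

import Mathlib

open Set Filter Topology
open scoped Pointwise

universe u v

/-- The norm of an ordered normed space is order continuous: `x_α ↓ 0` implies `‖x_α‖ → 0`
for every net. The index set of a decreasing net may be replaced by the range of the net,
so index sets from the universe of `E` are enough. -/
def HasOrderContinuousNorm (E : Type u) [NormedAddCommGroup E] [PartialOrder E] : Prop :=
  ∀ (ι : Type u) [Preorder ι] [IsDirectedOrder ι] [Nonempty ι] (x : ι → E),
    Antitone x → IsGLB (range x) 0 → Tendsto (fun i => ‖x i‖) atTop (𝓝 0)

/-- The usual order of the norm dual: `f ≤ g` iff `f x ≤ g x` for all `x ≥ 0`. -/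
@[reducible] def dualOrder (E : Type u) [NormedAddCommGroup E] [NormedSpace ℝ E] [Lattice E]
    [IsOrderedAddMonoid E] : PartialOrder (StrongDual ℝ E) where
  le f g := ∀ x : E, 0 ≤ x → f x ≤ g x
  le_refl _ _ _ := le_rfl
  le_trans _ _ _ h₁ h₂ x hx := (h₁ x hx).trans (h₂ x hx)
  le_antisymm f g h₁ h₂ := by
    ext x
    have key : ∀ y : E, 0 ≤ y → f y = g y := fun y hy => le_antisymm (h₁ y hy) (h₂ y hy)
    rw [← posPart_sub_negPart x, map_sub, map_sub, key _ (posPart_nonneg x),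
      key _ (negPart_nonneg x)]

/-- The norm of the dual `E'`, with the operator norm and the dual order, is order continuous. -/
def DualHasOrderContinuousNorm (E : Type u) [NormedAddCommGroup E] [NormedSpace ℝ E] [Lattice E]
    [IsOrderedAddMonoid E] : Prop :=
  letI := dualOrder E
  HasOrderContinuousNorm (StrongDual ℝ E)

/-- `A` is relatively weakly compact: its closure in the weak topology is weakly compact. -/
def IsRelativelyWeaklyCompact {X : Type u} [NormedAddCommGroup X] [NormedSpace ℝ X]
    (A : Set X) : Prop :=
  IsCompact (closure (toWeakSpace ℝ X '' A))

/-- `A` is L-weakly compact: it is norm bounded and every disjoint sequence in its solid hull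
converges to zero in norm. -/
def IsLWeaklyCompact {F : Type u} [NormedAddCommGroup F] [Lattice F] (A : Set F) : Prop :=
  Bornology.IsBounded A ∧
    ∀ y : ℕ → F, (∀ n, y n ∈ LatticeOrderedAddCommGroup.solidClosure A) → (∀ m n, m ≠ n → |y m| ⊓ |y n| = 0) →
      Tendsto (fun n => ‖y n‖) atTop (𝓝 0)

/-- An operator is almost L-weakly compact if it carries relatively weakly compact sets onto
L-weakly compact sets. -/
def IsAlmostLWeaklyCompact {X : Type u} {F : Type v} [NormedAddCommGroup X] [NormedSpace ℝ X]
    [NormedAddCommGroup F] [NormedSpace ℝ F] [Lattice F] (T : X →L[ℝ] F) : Prop :=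
  ∀ A : Set X, IsRelativelyWeaklyCompact A → IsLWeaklyCompact (T '' A)

/-- An operator is semi-compact if the image of the closed unit ball is almost order bounded. -/
def IsSemiCompact {X : Type u} {F : Type v} [NormedAddCommGroup X] [NormedSpace ℝ X]
    [NormedAddCommGroup F] [NormedSpace ℝ F] [Lattice F] (T : X →L[ℝ] F) : Prop :=
  ∀ ε : ℝ, 0 < ε → ∃ u : F, 0 ≤ u ∧
    T '' Metric.closedBall 0 1 ⊆ Icc (-u) u + ε • Metric.closedBall (0 : F) 1

/-!
# Semi-compactness of positive almost L-weakly compact operators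

Both directions rest on one approximation principle, `exists_norm_map_posPart_sub_le`: if a positive
operator `T` sends the disjoint sequences dominated by a bounded set `A` of positive elements to
norm null sequences, then for every `ε` there is `u ≥ 0` with `‖T (a - u)⁺‖ ≤ ε` for all `a ∈ A`.
It enters the description of order continuity of the norm of `E'` by disjoint sequences: this norm
is order continuous exactly when `f (s n) → 0` for every positive functional `f` and every bounded
disjoint sequence `s` of positive elements (`DualHasOrderContinuousNorm.tendsto_of_disjoint` and
`dualHasOrderContinuousNorm_of_forall_disjoint`).

Suppose that `E'` has order continuous norm and that `T` is positive and almost L-weakly compact. A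
bounded disjoint sequence `s ≥ 0` in `E` is then weakly null, so that `T (s n)` is a positive weakly
null sequence with L-weakly compact range. Up to a small error it lies in an order interval of
`F`, where positive weakly null sequences are norm null because the norm of `F` is order continuous
(`HasOrderContinuousNorm.tendsto_norm_of_weaklyNull`). Hence `‖T (s n)‖ → 0`, and the approximation
principle for the unit ball says that `T` is semi-compact. If `E` or `F` is finite-dimensional,
semi-compactness is immediate, since unit balls of finite-dimensional lattices are order bounded.

Conversely, if the norm of `E'` is not order continuous, there are a positive functional `f` and a
bounded disjoint sequence `s` with `f (s n) ≥ δ > 0`. The components `φ n` of `f` carried by the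
bands of the `s n` define an operator `x ↦ (φ n x)` from `E` to `ℓ¹`. An infinite-dimensional `F`
contains a disjoint sequence `y` of positive unit vectors, and `T x = ∑ φ n x • y n` is the operator
wanted. By the Schur property of `ℓ¹`
(`IsRelativelyWeaklyCompact.exists_sum_Ico_abs_le`) it is almost L-weakly compact. It is not
semi-compact: otherwise the image of the unit ball would be L-weakly compact, while its solid hull
contains the disjoint sequence `δ • y n`.
-/

/-! ### Vector lattices -/

section VectorLattice

variable {E : Type*} [AddCommGroup E] [Lattice E] [IsOrderedAddMonoid E]

theorem inf_add_le_inf_add_inf {a b c : E} (ha : 0 ≤ a) (hb : 0 ≤ b) (hc : 0 ≤ c) :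
    a ⊓ (b + c) ≤ a ⊓ b + a ⊓ c := by
  rw [inf_add, add_inf, add_inf]
  refine le_inf (le_inf ?_ ?_) (le_inf ?_ ?_)
  · exact inf_le_left.trans (le_add_of_nonneg_right ha)
  · exact inf_le_left.trans (le_add_of_nonneg_right hc)
  · exact inf_le_left.trans (le_add_of_nonneg_left hb)
  · exact inf_le_right

theorem le_inf_add_of_le_add {a u b : E} (hb : 0 ≤ b) (h : a ≤ u + b) : a ≤ a ⊓ u + b := by
  rw [inf_add]
  exact le_inf (le_add_of_nonneg_right hb) h

omit [IsOrderedAddMonoid E] in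
theorem inf_eq_zero_mono {a b a' b' : E} (ha : 0 ≤ a) (hb : 0 ≤ b) (haa : a ≤ a') (hbb : b ≤ b')
    (h : a' ⊓ b' = 0) : a ⊓ b = 0 :=
  le_antisymm ((inf_le_inf haa hbb).trans h.le) (le_inf ha hb)

theorem inf_sum_eq_zero {ι : Type*} {a : E} (ha : 0 ≤ a) {d : ι → E} (hd : ∀ i, 0 ≤ d i)
    (s : Finset ι) (h : ∀ i ∈ s, a ⊓ d i = 0) : a ⊓ ∑ i ∈ s, d i = 0 := by
  classical
  induction s using Finset.induction_on with
  | empty => simpa using ha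
  | insert i s hi ih =>
    rw [Finset.sum_insert hi]
    refine le_antisymm ((inf_add_le_inf_add_inf ha (hd i) (Finset.sum_nonneg fun j _ => hd j)).trans
      ?_) (le_inf ha (add_nonneg (hd i) (Finset.sum_nonneg fun j _ => hd j)))
    rw [h i (Finset.mem_insert_self i s),
      ih fun j hj => h j (Finset.mem_insert_of_mem hj), add_zero]

/-- A sum of pairwise disjoint positive elements is their supremum. -/
theorem sum_le_of_disjoint {ι : Type*} {d : ι → E} (hd : ∀ i, 0 ≤ d i)
    (hdis : ∀ i j, i ≠ j → d i ⊓ d j = 0) (s : Finset ι) {u : E} (hu : 0 ≤ u)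
    (h : ∀ i ∈ s, d i ≤ u) : ∑ i ∈ s, d i ≤ u := by
  classical
  induction s using Finset.induction_on with
  | empty => simpa using hu
  | insert i s hi ih =>
    rw [Finset.sum_insert hi]
    have h0 : d i ⊓ ∑ j ∈ s, d j = 0 :=
      inf_sum_eq_zero (hd i) hd s fun j hj => hdis i j (by rintro rfl; exact hi hj)
    rw [← inf_add_sup, h0, zero_add]
    exact sup_le (h i (Finset.mem_insert_self i s))
      (ih fun j hj => h j (Finset.mem_insert_of_mem hj))

theorem abs_sum_le {ι : Type*} (s : Finset ι) (g : ι → E) : |∑ i ∈ s, g i| ≤ ∑ i ∈ s, |g i| :=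
  Finset.le_sum_of_subadditive abs abs_zero.le abs_add_le s g

theorem eq_inf_add_posPart_sub (a b : E) : a = a ⊓ b + (a - b)⁺ := by
  rw [inf_eq_sub_posPart_sub]; abel

theorem posPart_sub_mono {a b c d : E} (hab : a ≤ b) (hcd : d ≤ c) : (a - c)⁺ ≤ (b - d)⁺ :=
  posPart_mono (sub_le_sub hab hcd)

theorem posPart_sub_le_self {a b : E} (ha : 0 ≤ a) (hb : 0 ≤ b) : (a - b)⁺ ≤ a :=
  sup_le (sub_le_self a hb) ha

variable [Module ℝ E] [IsOrderedModule ℝ E]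

omit [IsOrderedAddMonoid E] in
theorem smul_inf_of_pos {c : ℝ} (hc : 0 < c) (a b : E) : c • (a ⊓ b) = c • a ⊓ c • b :=
  (OrderIso.smulRight hc).map_inf a b

omit [IsOrderedAddMonoid E] in
theorem smul_sup_of_pos {c : ℝ} (hc : 0 < c) (a b : E) : c • (a ⊔ b) = c • a ⊔ c • b :=
  (OrderIso.smulRight hc).map_sup a b

omit [IsOrderedAddMonoid E] in
theorem posPart_smul_of_pos {c : ℝ} (hc : 0 < c) (a : E) : (c • a)⁺ = c • a⁺ := by
  rw [posPart_def, posPart_def, smul_sup_of_pos hc, smul_zero]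

omit [IsOrderedAddMonoid E] in
theorem abs_smul_le (c : ℝ) (a : E) : |c • a| ≤ |c| • |a| := by
  have key : ∀ (c : ℝ) (a : E), c • a ≤ |c| • |a| := fun c a => by
    rcases le_total 0 c with h | h
    · rw [abs_of_nonneg h]; exact smul_le_smul_of_nonneg_left (le_abs_self a) h
    · rw [abs_of_nonpos h, ← neg_smul_neg]
      exact smul_le_smul_of_nonneg_left (neg_le_abs a) (neg_nonneg.2 h)
  refine sup_le (key c a) ?_
  rw [← neg_smul, ← abs_neg c]
  exact key _ _

theorem smul_inf_smul_eq_zero {a b : E} (ha : 0 ≤ a) (hb : 0 ≤ b) (h : a ⊓ b = 0) {c d : ℝ}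
    (hc : 0 ≤ c) (hd : 0 ≤ d) : c • a ⊓ d • b = 0 := by
  have hm : 0 < max c d + 1 := by positivity
  refine inf_eq_zero_mono (smul_nonneg hc ha) (smul_nonneg hd hb)
    (smul_le_smul_of_nonneg_right (a₂ := max c d + 1) ?_ ha)
    (smul_le_smul_of_nonneg_right (a₂ := max c d + 1) ?_ hb) ?_
  · linarith [le_max_left c d]
  · linarith [le_max_right c d]
  · rw [← smul_inf_of_pos hm, h, smul_zero]

end VectorLattice

/-! ### Normed lattices and positive operators -/

section NormedLattice

variable {E : Type*} [NormedAddCommGroup E] [Lattice E] [IsOrderedAddMonoid E] [HasSolidNorm E]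

theorem norm_le_norm_of_nonneg_of_le {a b : E} (ha : 0 ≤ a) (hab : a ≤ b) : ‖a‖ ≤ ‖b‖ :=
  norm_le_norm_of_abs_le_abs (by rwa [abs_of_nonneg ha, abs_of_nonneg (ha.trans hab)])

theorem norm_posPart_le (a : E) : ‖a⁺‖ ≤ ‖a‖ := by
  rw [← norm_abs_eq_norm a]
  exact norm_le_norm_of_nonneg_of_le (posPart_nonneg a) (sup_le (le_abs_self a) (abs_nonneg a))

theorem norm_negPart_le (a : E) : ‖a⁻‖ ≤ ‖a‖ := by
  rw [← posPart_neg, ← norm_neg a]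
  exact norm_posPart_le _

variable [NormedSpace ℝ E] [IsOrderedModule ℝ E]

/-- Normed lattices are Archimedean. -/
theorem nonpos_of_forall_nsmul_le {w z : E} (h : ∀ k : ℕ, (k : ℝ) • w ≤ z) : w ≤ 0 := by
  have h1 : Tendsto (fun k : ℕ => ((k : ℝ) + 1)⁻¹ • z) atTop (𝓝 ((0 : ℝ) • z)) :=
    (tendsto_inv_atTop_zero.comp
      (tendsto_natCast_atTop_atTop.atTop_add tendsto_const_nhds)).smul_const z
  rw [zero_smul] at h1
  refine ge_of_tendsto' h1 fun k => ?_
  have h2 := smul_le_smul_of_nonneg_left (h (k + 1)) (a := ((k : ℝ) + 1)⁻¹) (by positivity)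
  rw [smul_smul] at h2
  push_cast at h2
  rwa [inv_mul_cancel₀ (by positivity), one_smul] at h2

omit [HasSolidNorm E] in
/-- In finite dimension the unit ball is order bounded. -/
theorem exists_abs_le_smul_of_finiteDimensional [FiniteDimensional ℝ E] :
    ∃ u : E, 0 ≤ u ∧ ∀ x : E, |x| ≤ ‖x‖ • u := by
  let b := Module.finBasis ℝ E
  have hc : ∀ i, ∃ C : ℝ, 0 ≤ C ∧ ∀ x, |b.coord i x| ≤ C * ‖x‖ := fun i =>
    ⟨‖LinearMap.toContinuousLinearMap (b.coord i)‖, norm_nonneg _,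
      fun x => (LinearMap.toContinuousLinearMap (b.coord i)).le_opNorm x⟩
  choose C hC0 hC using hc
  refine ⟨∑ i, C i • |b i|, Finset.sum_nonneg fun i _ => smul_nonneg (hC0 i) (abs_nonneg _),
    fun x => ?_⟩
  have h := (abs_sum_le Finset.univ fun i => b.coord i x • b i).trans
    (Finset.sum_le_sum fun i _ => (abs_smul_le _ _).trans
      (smul_le_smul_of_nonneg_right (hC i x) (abs_nonneg (b i))))
  simp only [mul_comm _ ‖x‖, mul_smul, ← Finset.smul_sum] at h
  simpa [b.sum_repr x] using h

omit [HasSolidNorm E] [IsOrderedModule ℝ E] in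
theorem map_mono_of_nonneg {G : Type*} [AddCommGroup G] [PartialOrder G] [IsOrderedAddMonoid G]
    [Module ℝ G] [TopologicalSpace G]
    (T : E →L[ℝ] G) (hT : ∀ x, 0 ≤ x → 0 ≤ T x) {x y : E} (h : x ≤ y) : T x ≤ T y := by
  rw [← sub_nonneg, ← map_sub]
  exact hT _ (sub_nonneg.2 h)

omit [HasSolidNorm E] [IsOrderedModule ℝ E] in
theorem abs_map_le {G : Type*} [AddCommGroup G] [Lattice G] [IsOrderedAddMonoid G]
    [Module ℝ G] [TopologicalSpace G]
    (T : E →L[ℝ] G) (hT : ∀ x, 0 ≤ x → 0 ≤ T x) (x : E) : |T x| ≤ T |x| := by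
  refine sup_le (map_mono_of_nonneg T hT (le_abs_self x)) ?_
  rw [← map_neg]
  exact map_mono_of_nonneg T hT (neg_le_abs x)

end NormedLattice

/-! ### Positive functionals and their components -/

section Functionals

variable {E : Type*} [NormedAddCommGroup E] [NormedSpace ℝ E] [Lattice E] [IsOrderedAddMonoid E]
  [IsOrderedModule ℝ E] [HasSolidNorm E]

omit [IsOrderedModule ℝ E] in
/-- Kantorovich extension: an additive, positive, bounded function on the positive cone is the
restriction of a continuous linear functional. -/
theorem exists_clm_eq_of_additive (p : E → ℝ)
    (hadd : ∀ x y, 0 ≤ x → 0 ≤ y → p (x + y) = p x + p y) (h0 : ∀ x, 0 ≤ x → 0 ≤ p x)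
    {C : ℝ} (hC0 : 0 ≤ C) (hC : ∀ x, 0 ≤ x → p x ≤ C * ‖x‖) :
    ∃ g : E →L[ℝ] ℝ, ∀ x, 0 ≤ x → g x = p x := by
  have hp0 : p 0 = 0 := by simpa using hadd 0 0 le_rfl le_rfl
  let g₀ : E →+ ℝ :=
    { toFun := fun x => p x⁺ - p x⁻
      map_zero' := by simp
      map_add' := fun x y => by
        have h1 : (x + y)⁺ + (x⁻ + y⁻) = (x + y)⁻ + (x⁺ + y⁺) := by
          have a := posPart_sub_negPart (x + y)
          have b := posPart_sub_negPart x
          have c := posPart_sub_negPart y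
          rw [← sub_eq_zero]
          calc _ = ((x + y)⁺ - (x + y)⁻) - (x⁺ - x⁻) - (y⁺ - y⁻) := by abel
            _ = 0 := by rw [a, b, c]; abel
        have h2 := congrArg p h1
        have hx := posPart_nonneg x
        have hx' := negPart_nonneg x
        have hy := posPart_nonneg y
        have hy' := negPart_nonneg y
        rw [hadd _ _ (posPart_nonneg _) (add_nonneg hx' hy'),
          hadd _ _ (negPart_nonneg _) (add_nonneg hx hy), hadd _ _ hx hy, hadd _ _ hx' hy'] at h2
        linarith }
  have hbound : ∀ x, ‖g₀ x‖ ≤ C * ‖x‖ := fun x => by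
    have h1 := hC _ (posPart_nonneg x)
    have h2 := hC _ (negPart_nonneg x)
    have h3 := h0 _ (posPart_nonneg x)
    have h4 := h0 _ (negPart_nonneg x)
    have h5 := mul_le_mul_of_nonneg_left (norm_posPart_le x) hC0
    have h6 := mul_le_mul_of_nonneg_left (norm_negPart_le x) hC0
    change |p x⁺ - p x⁻| ≤ _
    rw [abs_le]
    constructor <;> linarith
  refine ⟨g₀.toRealLinearMap (AddMonoidHomClass.continuous_of_bound g₀ C hbound), fun x hx => ?_⟩
  change p x⁺ - p x⁻ = p x
  rw [posPart_eq_self.2 hx, negPart_eq_zero.2 hx, hp0, sub_zero]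

omit [IsOrderedModule ℝ E] in
/-- The Riesz–Kantorovich formula provides a positive majorant of a functional, with no larger
norm. -/
theorem exists_nonneg_majorant (h : E →L[ℝ] ℝ) :
    ∃ g : E →L[ℝ] ℝ, ∀ x, 0 ≤ x → 0 ≤ g x ∧ h x ≤ g x ∧ g x ≤ ‖h‖ * ‖x‖ := by
  let p : E → ℝ := fun x => sSup (h '' Icc 0 x)
  have hub : ∀ x, ∀ y ∈ h '' Icc 0 x, y ≤ ‖h‖ * ‖x‖ := by
    rintro x _ ⟨y, hy, rfl⟩
    exact (le_abs_self _).trans ((h.le_opNorm y).trans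
      (mul_le_mul_of_nonneg_left (norm_le_norm_of_nonneg_of_le hy.1 hy.2) (norm_nonneg h)))
  have hbdd : ∀ x, BddAbove (h '' Icc 0 x) := fun x => ⟨_, hub x⟩
  have hne : ∀ x : E, 0 ≤ x → (h '' Icc 0 x).Nonempty := fun x hx => ⟨_, 0, ⟨le_rfl, hx⟩, rfl⟩
  have h0 : ∀ x, 0 ≤ x → 0 ≤ p x := fun x hx => le_csSup (hbdd x) ⟨0, ⟨le_rfl, hx⟩, map_zero h⟩
  have hle : ∀ x, 0 ≤ x → h x ≤ p x := fun x hx => le_csSup (hbdd x) ⟨x, ⟨hx, le_rfl⟩, rfl⟩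
  have hC : ∀ x, 0 ≤ x → p x ≤ ‖h‖ * ‖x‖ := fun x hx => csSup_le (hne x hx) (hub x)
  have hadd : ∀ x y, 0 ≤ x → 0 ≤ y → p (x + y) = p x + p y := by
    intro x y hx hy
    apply le_antisymm
    · refine csSup_le (hne _ (add_nonneg hx hy)) ?_
      rintro _ ⟨z, hz, rfl⟩
      -- Riesz decomposition of `z` along `x + y`.
      have hz1 : (z - x)⁺ ≤ y := sup_le (sub_le_iff_le_add'.2 hz.2) hy
      rw [eq_inf_add_posPart_sub z x, map_add]
      exact add_le_add (le_csSup (hbdd x) ⟨_, ⟨le_inf hz.1 hx, inf_le_right⟩, rfl⟩)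
        (le_csSup (hbdd y) ⟨_, ⟨posPart_nonneg _, hz1⟩, rfl⟩)
    · rw [← le_sub_iff_add_le]
      refine csSup_le (hne x hx) ?_
      rintro _ ⟨a, ha, rfl⟩
      rw [le_sub_comm]
      refine csSup_le (hne y hy) ?_
      rintro _ ⟨b, hb, rfl⟩
      rw [le_sub_iff_add_le', ← map_add]
      exact le_csSup (hbdd _) ⟨_, ⟨add_nonneg ha.1 hb.1, add_le_add ha.2 hb.2⟩, rfl⟩
  obtain ⟨g, hg⟩ := exists_clm_eq_of_additive p hadd h0 (norm_nonneg h) hC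
  exact ⟨g, fun x hx => by rw [hg x hx]; exact ⟨h0 x hx, hle x hx, hC x hx⟩⟩

/-- The component of a positive functional `f` carried by the band generated by `s`, given on
`x ≥ 0` by `lim f (x ⊓ k • s)`. -/
theorem exists_band_component (f : E →L[ℝ] ℝ) (hf : ∀ x, 0 ≤ x → 0 ≤ f x) {s : E} (hs : 0 ≤ s) :
    ∃ g : E →L[ℝ] ℝ, ∀ x, 0 ≤ x →
      Tendsto (fun k : ℕ => f (x ⊓ (k : ℝ) • s)) atTop (𝓝 (g x)) := by
  have hks : ∀ k : ℕ, 0 ≤ (k : ℝ) • s := fun k => smul_nonneg k.cast_nonneg hs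
  have hfm : ∀ {x y : E}, x ≤ y → f x ≤ f y := fun h => map_mono_of_nonneg f hf h
  have hub : ∀ x (k : ℕ), f (x ⊓ (k : ℝ) • s) ≤ f x := fun x k => hfm inf_le_left
  have hlim : ∀ x, Tendsto (fun k : ℕ => f (x ⊓ (k : ℝ) • s)) atTop
      (𝓝 (⨆ k : ℕ, f (x ⊓ (k : ℝ) • s))) := fun x => by
    refine tendsto_atTop_ciSup (fun i j hij => hfm (inf_le_inf_left _ ?_))
      ⟨f x, by rintro _ ⟨k, rfl⟩; exact hub x k⟩
    exact smul_le_smul_of_nonneg_right (by exact_mod_cast hij) hs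
  have hadd : ∀ x y : E, 0 ≤ x → 0 ≤ y → (⨆ k : ℕ, f ((x + y) ⊓ (k : ℝ) • s)) =
      (⨆ k : ℕ, f (x ⊓ (k : ℝ) • s)) + ⨆ k : ℕ, f (y ⊓ (k : ℝ) • s) := by
    intro x y hx hy
    apply le_antisymm
    · refine le_of_tendsto_of_tendsto' (hlim (x + y)) ((hlim x).add (hlim y)) fun k => ?_
      rw [← map_add]
      refine hfm ?_
      rw [inf_comm, inf_comm x, inf_comm y]
      exact inf_add_le_inf_add_inf (hks k) hx hy
    · refine le_of_tendsto_of_tendsto' ((hlim x).add (hlim y))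
        ((hlim (x + y)).comp (tendsto_id.const_mul_atTop' (r := 2) two_pos)) fun k => ?_
      simp only [Function.comp, ← map_add]
      refine hfm (le_inf (add_le_add inf_le_left inf_le_left) ?_)
      rw [id, Nat.cast_mul, Nat.cast_two, mul_smul, two_smul]
      exact add_le_add inf_le_right inf_le_right
  obtain ⟨g, hg⟩ := exists_clm_eq_of_additive (fun x => ⨆ k : ℕ, f (x ⊓ (k : ℝ) • s)) hadd
    (fun x hx => ge_of_tendsto' (hlim x) fun k => hf _ (le_inf hx (hks k))) (norm_nonneg f)
    (fun x _ => (le_of_tendsto' (hlim x) (hub x)).trans ((le_abs_self _).trans (f.le_opNorm x)))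
  exact ⟨g, fun x hx => by rw [hg x hx]; exact hlim x⟩

/-- A positive functional dominates the sum of its components along a disjoint sequence. -/
theorem exists_disjoint_components (f : E →L[ℝ] ℝ) (hf : ∀ x, 0 ≤ x → 0 ≤ f x) {s : ℕ → E}
    (hs : ∀ n, 0 ≤ s n) (hdis : ∀ m n, m ≠ n → s m ⊓ s n = 0) :
    ∃ φ : ℕ → E →L[ℝ] ℝ, (∀ n x, 0 ≤ x → 0 ≤ φ n x) ∧
      (∀ x, 0 ≤ x → ∀ N, ∑ n ∈ Finset.range N, φ n x ≤ f x) ∧ (∀ n, φ n (s n) = f (s n)) ∧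
      ∀ m n, m ≠ n → φ n (s m) = 0 := by
  choose φ hφ using fun n => exists_band_component f hf (hs n)
  have hks : ∀ n (k : ℕ), 0 ≤ (k : ℝ) • s n := fun n k => smul_nonneg k.cast_nonneg (hs n)
  refine ⟨φ, fun n x hx => ge_of_tendsto' (hφ n x hx) fun k => hf _ (le_inf hx (hks n k)),
    fun x hx N => ?_, fun n => ?_, fun m n hmn => ?_⟩
  · refine le_of_tendsto' (tendsto_finsetSum _ fun n _ => hφ n x hx) fun k => ?_
    rw [← map_sum]
    refine map_mono_of_nonneg f hf (sum_le_of_disjoint (fun n => le_inf hx (hks n k)) ?_ _ hx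
      fun n _ => inf_le_left)
    intro i j hij
    exact inf_eq_zero_mono (le_inf hx (hks i k)) (le_inf hx (hks j k)) inf_le_right inf_le_right
      (smul_inf_smul_eq_zero (hs i) (hs j) (hdis i j hij) k.cast_nonneg k.cast_nonneg)
  · refine tendsto_nhds_unique (hφ n (s n) (hs n)) (tendsto_const_nhds.congr' ?_)
    filter_upwards [eventually_ge_atTop 1] with k hk
    rw [inf_eq_left.2]
    have := smul_le_smul_of_nonneg_right (a₁ := (1 : ℝ)) (a₂ := k) (by exact_mod_cast hk) (hs n)
    rwa [one_smul] at this
  · refine tendsto_nhds_unique (hφ n (s m) (hs m)) (tendsto_const_nhds.congr fun k => ?_)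
    have := smul_inf_smul_eq_zero (hs m) (hs n) (hdis m n hmn) zero_le_one k.cast_nonneg
    rw [one_smul] at this
    rw [this, map_zero]

omit [IsOrderedModule ℝ E] in
theorem sum_abs_le_of_sum_le {f : E →L[ℝ] ℝ} {φ : ℕ → E →L[ℝ] ℝ}
    (h0 : ∀ n x, 0 ≤ x → 0 ≤ φ n x)
    (hφ : ∀ x, 0 ≤ x → ∀ N, ∑ n ∈ Finset.range N, φ n x ≤ f x) (x : E) (N : ℕ) :
    ∑ n ∈ Finset.range N, |φ n x| ≤ ‖f‖ * ‖x‖ :=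
  calc ∑ n ∈ Finset.range N, |φ n x| ≤ ∑ n ∈ Finset.range N, φ n |x| :=
        Finset.sum_le_sum fun n _ => abs_map_le (φ n) (h0 n) x
    _ ≤ f |x| := hφ _ (abs_nonneg x) N
    _ ≤ ‖f‖ * ‖|x|‖ := (le_abs_self _).trans (f.le_opNorm _)
    _ = ‖f‖ * ‖x‖ := by rw [norm_abs_eq_norm]

end Functionals

/-- The operator `x ↦ ∑ φ n x • y n`, which factors through `ℓ¹`. -/
theorem exists_clm_hasSum {X Y : Type*} [NormedAddCommGroup X] [NormedSpace ℝ X]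
    [NormedAddCommGroup Y] [NormedSpace ℝ Y] [CompleteSpace Y] {φ : ℕ → X →L[ℝ] ℝ} {C : ℝ}
    (hφ : ∀ x N, ∑ n ∈ Finset.range N, |φ n x| ≤ C * ‖x‖) {y : ℕ → Y} (hy : ∀ n, ‖y n‖ ≤ 1) :
    ∃ T : X →L[ℝ] Y, ∀ x, HasSum (fun n => φ n x • y n) (T x) := by
  have hle : ∀ n x, ‖φ n x • y n‖ ≤ |φ n x| := fun n x => by
    rw [norm_smul, Real.norm_eq_abs]
    exact mul_le_of_le_one_right (abs_nonneg _) (hy n)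
  have hsa : ∀ x, Summable fun n => |φ n x| := fun x =>
    summable_of_sum_range_le (fun n => abs_nonneg _) (hφ x)
  have hs : ∀ x, Summable fun n => φ n x • y n := fun x =>
    Summable.of_norm_bounded (hsa x) fun n => hle n x
  let T₀ : X →ₗ[ℝ] Y :=
    { toFun := fun x => ∑' n, φ n x • y n
      map_add' := fun x z => by
        rw [← (hs x).tsum_add (hs z)]
        simp only [map_add, add_smul]
      map_smul' := fun c x => by
        rw [RingHom.id_apply, ← (hs x).tsum_const_smul c]
        simp only [map_smul, smul_eq_mul, mul_smul] }
  refine ⟨T₀.mkContinuous C fun x => ?_, fun x => (hs x).hasSum⟩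
  exact (tsum_of_norm_bounded (hsa x).hasSum fun n => hle n x).trans
    ((hsa x).tsum_le_of_sum_range_le (hφ x))

/-! ### Disjoint sequences and domination up to a small error -/

section Approximation

variable {E : Type*} [NormedAddCommGroup E] [NormedSpace ℝ E] [CompleteSpace E] [Lattice E]
  [IsOrderedAddMonoid E] [IsOrderedModule ℝ E] [HasSolidNorm E]
  {G : Type*} [NormedAddCommGroup G] [NormedSpace ℝ G] [Lattice G]
  [IsOrderedAddMonoid G] [HasSolidNorm G]

omit [CompleteSpace E] [HasSolidNorm E] in
theorem inf_posPart_sub_smul_eq_zero {a b : E} {c : ℝ} (hc : 1 ≤ c) :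
    (a - c⁻¹ • b)⁺ ⊓ (b - c • a)⁺ = 0 := by
  have hc0 : 0 < c := by positivity
  have h1 : (a - c⁻¹ • b)⁺ = c⁻¹ • (b - c • a)⁻ := by
    rw [← posPart_neg, ← posPart_smul_of_pos (inv_pos.2 hc0), neg_sub, smul_sub, smul_smul,
      inv_mul_cancel₀ hc0.ne', one_smul]
  have h2 := smul_inf_smul_eq_zero (negPart_nonneg (b - c • a)) (posPart_nonneg (b - c • a))
    (by rw [inf_comm]; exact posPart_inf_negPart_eq_zero _) (inv_nonneg.2 hc0.le) zero_le_one
  rwa [one_smul, ← h1] at h2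

/-- If a positive operator maps the disjoint sequences dominated by elements of a bounded set `A` to
norm null sequences, then modulo a small error `A` is dominated by a single element. -/
theorem exists_norm_map_posPart_sub_le {A : Set E} (hA0 : ∀ a ∈ A, 0 ≤ a) {C : ℝ}
    (hAC : ∀ a ∈ A, ‖a‖ ≤ C) (T : E →L[ℝ] G) (hT : ∀ x, 0 ≤ x → 0 ≤ T x)
    (h : ∀ v : ℕ → E, (∀ n, 0 ≤ v n) → (∀ n, ∃ a ∈ A, v n ≤ a) →
      (∀ m n, m ≠ n → v m ⊓ v n = 0) → Tendsto (fun n => ‖T (v n)‖) atTop (𝓝 0))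
    {ε : ℝ} (hε : 0 < ε) : ∃ u : E, 0 ≤ u ∧ ∀ a ∈ A, ‖T (a - u)⁺‖ ≤ ε := by
  by_contra! hcon
  choose! pick hpA hpε using hcon
  -- `S n` is the sum of the first `n` terms of the sequence `a`.
  let S : ℕ → E := fun n => Nat.rec 0 (fun n s => s + pick ((4 : ℝ) ^ n • s)) n
  let a : ℕ → E := fun n => pick ((4 : ℝ) ^ n • S n)
  have hSs : ∀ n, S (n + 1) = S n + a n := fun n => rfl
  have hS0 : ∀ n, 0 ≤ S n := by
    intro n
    induction n with
    | zero => exact le_rfl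
    | succ n ih => exact add_nonneg ih (hA0 _ (hpA _ (smul_nonneg (by positivity) ih)))
  have h4S : ∀ n, 0 ≤ (4 : ℝ) ^ n • S n := fun n => smul_nonneg (by positivity) (hS0 n)
  have haA : ∀ n, a n ∈ A := fun n => hpA _ (h4S n)
  have ha0 : ∀ n, 0 ≤ a n := fun n => hA0 _ (haA n)
  have haε : ∀ n, ε < ‖T (a n - (4 : ℝ) ^ n • S n)⁺‖ := fun n => hpε _ (h4S n)
  have hSm : Monotone S := monotone_nat_of_le_succ fun n => by
    rw [hSs]; exact le_add_of_nonneg_right (ha0 n)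
  have haS : ∀ {n m}, n < m → a n ≤ S m := fun {n m} hnm =>
    (le_add_of_nonneg_left (hS0 n)).trans ((hSs n).symm.le.trans (hSm (Nat.succ_le_of_lt hnm)))
  have hsum : Summable fun n => ((2 : ℝ)⁻¹) ^ n • a n := by
    refine Summable.of_norm_bounded
      ((summable_geometric_of_lt_one (r := (2 : ℝ)⁻¹) (by norm_num) (by norm_num)).mul_right C)
      fun n => ?_
    rw [norm_smul, Real.norm_of_nonneg (by positivity)]
    exact mul_le_mul_of_nonneg_left (hAC _ (haA n)) (by positivity)
  set x := ∑' n, ((2 : ℝ)⁻¹) ^ n • a n with hx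
  have hterm : ∀ n, 0 ≤ ((2 : ℝ)⁻¹) ^ n • a n := fun n => smul_nonneg (by positivity) (ha0 n)
  have hx0 : 0 ≤ x := tsum_nonneg hterm
  have hax : ∀ n, ((2 : ℝ)⁻¹) ^ n • a n ≤ x := fun n => hsum.le_tsum n fun m _ => hterm m
  have h2x : ∀ n, 0 ≤ ((2 : ℝ)⁻¹) ^ n • x := fun n => smul_nonneg (by positivity) hx0
  -- Since `x` dominates every `a m` up to a factor, subtracting also a small multiple of `x` makes
  -- the truncations disjoint, at a cost that tends to `0`.
  let v : ℕ → E := fun n => (a n - ((4 : ℝ) ^ n • S n + ((2 : ℝ)⁻¹) ^ n • x))⁺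
  have hdis : ∀ n m, n < m → v n ⊓ v m = 0 := by
    intro n m hnm
    refine inf_eq_zero_mono (posPart_nonneg _) (posPart_nonneg _) ?_ ?_
      (inf_posPart_sub_smul_eq_zero (a := a n) (b := a m) (c := (4 : ℝ) ^ m)
        (one_le_pow₀ (by norm_num)))
    · refine posPart_sub_mono le_rfl (le_trans ?_ (le_add_of_nonneg_left (h4S n)))
      refine le_trans ?_ (smul_le_smul_of_nonneg_left (hax m) (by positivity))
      rw [smul_smul, ← pow_add]
      refine smul_le_smul_of_nonneg_right ?_ (ha0 m)
      rw [← inv_pow, show (4 : ℝ)⁻¹ = (2 : ℝ)⁻¹ ^ 2 by norm_num, ← pow_mul]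
      exact pow_le_pow_of_le_one (by norm_num) (by norm_num) (by omega)
    · exact posPart_sub_mono le_rfl
        ((smul_le_smul_of_nonneg_left (haS hnm) (by positivity)).trans
          (le_add_of_nonneg_right (h2x m)))
  have hv := h v (fun n => posPart_nonneg _)
    (fun n => ⟨a n, haA n, posPart_sub_le_self (ha0 n) (add_nonneg (h4S n) (h2x n))⟩)
    (fun m n hmn => by
      rcases lt_or_gt_of_ne hmn with h' | h'
      · exact hdis m n h'
      · rw [inf_comm]; exact hdis n m h')
  have hle : ∀ n, ‖T (a n - (4 : ℝ) ^ n • S n)⁺‖ ≤ ‖T (v n)‖ + ((2 : ℝ)⁻¹) ^ n * ‖T x‖ := by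
    intro n
    have h1 : (a n - (4 : ℝ) ^ n • S n)⁺ ≤ v n + ((2 : ℝ)⁻¹) ^ n • x := by
      refine sup_le ?_ (add_nonneg (posPart_nonneg _) (h2x n))
      rw [← sub_le_iff_le_add, sub_sub]
      exact le_posPart _
    have h2 := norm_le_norm_of_nonneg_of_le (hT _ (posPart_nonneg _)) (map_mono_of_nonneg T hT h1)
    refine h2.trans ?_
    rw [map_add, map_smul]
    refine (norm_add_le _ _).trans_eq ?_
    rw [norm_smul, Real.norm_of_nonneg (by positivity)]
  have hlim : Tendsto (fun n => ‖T (v n)‖ + ((2 : ℝ)⁻¹) ^ n * ‖T x‖) atTop (𝓝 0) := by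
    have := hv.add ((tendsto_pow_atTop_nhds_zero_of_lt_one (r := (2 : ℝ)⁻¹) (by norm_num)
      (by norm_num)).mul_const ‖T x‖)
    simpa using this
  exact absurd (ge_of_tendsto' hlim fun n => (haε n).le.trans (hle n)) (not_le.2 hε)

end Approximation

/-! ### Order continuous norms -/

theorem exists_strictMono_forall_le_of_not_tendsto_zero {r : ℕ → ℝ} (h0 : ∀ n, 0 ≤ r n)
    (h : ¬ Tendsto r atTop (𝓝 0)) :
    ∃ δ : ℝ, 0 < δ ∧ ∃ φ : ℕ → ℕ, StrictMono φ ∧ ∀ n, δ ≤ r (φ n) := by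
  rw [Metric.tendsto_atTop] at h
  push Not at h
  obtain ⟨δ, hδ, h⟩ := h
  obtain ⟨φ, hφ, hφδ⟩ := extraction_of_frequently_atTop
    (P := fun n => δ ≤ r n) (frequently_atTop.2 fun N => by
      obtain ⟨n, hn, hn'⟩ := h N
      rw [dist_zero_right, Real.norm_of_nonneg (h0 n)] at hn'
      exact ⟨n, hn, hn'⟩)
  exact ⟨δ, hδ, φ, hφ, hφδ⟩

section OrderContinuous

variable {F : Type v} [NormedAddCommGroup F] [NormedSpace ℝ F] [Lattice F] [IsOrderedAddMonoid F]
  [IsOrderedModule ℝ F] [HasSolidNorm F]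

/-- For an order continuous norm, increasing order bounded sequences are Cauchy. The net to consider
consists of the differences between upper bounds and terms of the sequence; it decreases to `0`
because the lattice is Archimedean. -/
theorem HasOrderContinuousNorm.cauchySeq_of_monotone (hF : HasOrderContinuousNorm F) {x : ℕ → F}
    (hx : Monotone x) {u : F} (hu : ∀ n, x n ≤ u) : CauchySeq x := by
  let D := {y : F // ∀ n, x n ≤ y}
  let net : Dᵒᵈ × ℕ → F := fun p => (OrderDual.ofDual p.1).1 - x p.2
  have : Nonempty Dᵒᵈ := ⟨OrderDual.toDual ⟨u, hu⟩⟩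
  have : IsDirectedOrder Dᵒᵈ := ⟨fun a b =>
    ⟨OrderDual.toDual ⟨(OrderDual.ofDual a).1 ⊓ (OrderDual.ofDual b).1, fun n =>
      le_inf ((OrderDual.ofDual a).2 n) ((OrderDual.ofDual b).2 n)⟩, inf_le_left, inf_le_right⟩⟩
  have : IsDirectedOrder (Dᵒᵈ × ℕ) := ⟨fun p q => by
    obtain ⟨c, hpc, hqc⟩ := exists_ge_ge p.1 q.1
    exact ⟨(c, max p.2 q.2), ⟨hpc, le_max_left _ _⟩, ⟨hqc, le_max_right _ _⟩⟩⟩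
  have hanti : Antitone net := fun p q hpq => sub_le_sub hpq.1 (hx hpq.2)
  have hglb : IsGLB (range net) 0 := by
    refine ⟨?_, fun w hw => ?_⟩
    · rintro _ ⟨p, rfl⟩
      exact sub_nonneg.2 ((OrderDual.ofDual p.1).2 p.2)
    · have hstep : ∀ y : F, (∀ n, x n ≤ y) → ∀ n, x n ≤ y - w := fun y hy n =>
        le_sub_comm.1 (hw ⟨(OrderDual.toDual ⟨y, hy⟩, n), rfl⟩)
      have hk : ∀ k : ℕ, ∀ n, x n ≤ u - (k : ℝ) • w := by
        intro k
        induction k with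
        | zero => simpa using hu
        | succ k ih =>
          have := hstep _ ih
          simpa [add_smul, sub_sub] using this
      exact nonpos_of_forall_nsmul_le (z := u - x 0) fun k => le_sub_comm.1 (hk k 0)
  have hlim := hF (Dᵒᵈ × ℕ) net hanti hglb
  rw [Metric.cauchySeq_iff']
  intro ε hε
  obtain ⟨p, hp⟩ := (hlim.eventually (gt_mem_nhds (half_pos hε))).exists_forall_of_atTop
  refine ⟨p.2, fun n hn => ?_⟩
  have h1 := hp p le_rfl
  have h2 := hp (p.1, n) ⟨le_rfl, hn⟩
  calc dist (x n) (x p.2) = ‖net p - net (p.1, n)‖ := by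
        rw [dist_eq_norm]; congr 1; simp only [net]; abel
    _ ≤ ‖net p‖ + ‖net (p.1, n)‖ := norm_sub_le _ _
    _ < ε := by linarith

/-- The partial sums of a disjoint order bounded sequence stay below the same bound, hence form a
Cauchy sequence. -/
theorem HasOrderContinuousNorm.tendsto_norm_of_disjoint (hF : HasOrderContinuousNorm F) {d : ℕ → F}
    (hd : ∀ n, 0 ≤ d n) (hdis : ∀ m n, m ≠ n → d m ⊓ d n = 0) {u : F} (hu : ∀ n, d n ≤ u) :
    Tendsto (fun n => ‖d n‖) atTop (𝓝 0) := by
  have hmono : Monotone fun N => ∑ n ∈ Finset.range N, d n :=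
    monotone_nat_of_le_succ fun N => by
      rw [Finset.sum_range_succ]; exact le_add_of_nonneg_right (hd N)
  have hc := hF.cauchySeq_of_monotone hmono fun N =>
    sum_le_of_disjoint hd hdis _ ((hd 0).trans (hu 0)) fun n _ => hu n
  rw [Metric.cauchySeq_iff'] at hc
  rw [Metric.tendsto_atTop]
  intro ε hε
  obtain ⟨N, hN⟩ := hc (ε / 2) (half_pos hε)
  refine ⟨N, fun n hn => ?_⟩
  have h1 := hN n hn
  have h2 := hN (n + 1) (by omega)
  have h3 := dist_triangle_right (∑ i ∈ Finset.range (n + 1), d i) (∑ i ∈ Finset.range n, d i)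
    (∑ i ∈ Finset.range N, d i)
  rw [dist_eq_norm (∑ i ∈ Finset.range (n + 1), d i) (∑ i ∈ Finset.range n, d i),
    Finset.sum_range_succ_sub_sum] at h3
  rw [dist_zero_right, norm_norm]
  linarith

variable [CompleteSpace F]

theorem HasOrderContinuousNorm.exists_tendsto_partialSups (hF : HasOrderContinuousNorm F)
    {w : ℕ → F} {u : F} (hu : ∀ n, w n ≤ u) :
    ∃ s, IsLUB (range w) s ∧ Tendsto (partialSups w) atTop (𝓝 s) := by
  obtain ⟨s, hs⟩ := cauchySeq_tendsto_of_complete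
    (hF.cauchySeq_of_monotone (partialSups w).monotone
      fun n => partialSups_le w n u fun k _ => hu k)
  refine ⟨s, ?_, hs⟩
  have h := isLUB_of_tendsto_atTop (partialSups w).monotone hs
  rwa [IsLUB, upperBounds_range_partialSups] at h

/-- On order intervals of a lattice with order continuous norm, weakly null sequences of positive
elements are norm null. If the norms stayed above `δ`, then successively thinner subsequences,
each of small total mass for a functional that is large at the supremum of the previous one, would
have suprema that decrease by at least `δ / 2` in norm at each step. -/
theorem HasOrderContinuousNorm.tendsto_norm_of_weaklyNull (hF : HasOrderContinuousNorm F)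
    {w : ℕ → F} (hw : ∀ n, 0 ≤ w n) {u : F} (hu : ∀ n, w n ≤ u)
    (hnull : ∀ g : F →L[ℝ] ℝ, (∀ x, 0 ≤ x → 0 ≤ g x) → Tendsto (fun n => g (w n)) atTop (𝓝 0)) :
    Tendsto (fun n => ‖w n‖) atTop (𝓝 0) := by
  by_contra hcon
  obtain ⟨δ, hδ, φ₀, hφ₀, hφ₀δ⟩ :=
    exists_strictMono_forall_le_of_not_tendsto_zero (fun n => norm_nonneg (w n)) hcon
  let D := {s : F // ∃ φ : ℕ → ℕ, StrictMono φ ∧ (∀ n, δ ≤ ‖w (φ n)‖) ∧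
    IsLUB (range (w ∘ φ)) s}
  have hstep : ∀ s : D, ∃ s' : D, s'.1 ≤ s.1 ∧ δ / 2 ≤ ‖s.1 - s'.1‖ := by
    rintro ⟨s, φ, hφ, hφδ, hs⟩
    have hs0 : 0 ≤ s := (hw (φ 0)).trans (hs.1 ⟨0, rfl⟩)
    have hsδ : δ ≤ ‖s‖ := (hφδ 0).trans
      (norm_le_norm_of_nonneg_of_le (hw _) (hs.1 ⟨0, rfl⟩))
    obtain ⟨h, hh1, hhs⟩ := exists_dual_vector'' ℝ s
    obtain ⟨g, hg⟩ := exists_nonneg_majorant h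
    have hgs : δ ≤ g s := by
      have := (hg s hs0).2.1
      rw [hhs] at this
      exact hsδ.trans this
    have hg1 : ∀ y, 0 ≤ y → g y ≤ ‖y‖ := fun y hy => (hg y hy).2.2.trans
      (mul_le_of_le_one_left (norm_nonneg y) hh1)
    obtain ⟨ψ, hψ, hψg⟩ := extraction_forall_of_eventually
      (P := fun n k => g (w (φ k)) < δ / 2 * (2⁻¹) ^ (n + 1)) (fun n =>
        ((hnull g fun x hx => (hg x hx).1).comp hφ.tendsto_atTop).eventually
          (gt_mem_nhds (by positivity)))
    obtain ⟨s', hs', hlim⟩ := hF.exists_tendsto_partialSups (w := w ∘ φ ∘ ψ) fun n => hu _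
    have hss' : s' ≤ s := hs'.2 (by rintro _ ⟨n, rfl⟩; exact hs.1 ⟨ψ n, rfl⟩)
    refine ⟨⟨s', φ ∘ ψ, hφ.comp hψ, fun n => hφδ _, hs'⟩, hss', ?_⟩
    have hgs' : g s' ≤ δ / 2 := by
      refine le_of_tendsto' ((g.continuous.tendsto _).comp hlim) fun n => ?_
      have h1 : partialSups (w ∘ φ ∘ ψ) n ≤ ∑ k ∈ Finset.range (n + 1), w (φ (ψ k)) :=
        partialSups_le _ _ _ fun k hk => Finset.single_le_sum (f := fun k => w (φ (ψ k)))
          (fun _ _ => hw _) (Finset.mem_range.2 (by omega))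
      have h2 := map_mono_of_nonneg g (fun x hx => (hg x hx).1) h1
      refine h2.trans ?_
      rw [map_sum]
      calc ∑ k ∈ Finset.range (n + 1), g (w (φ (ψ k)))
          ≤ ∑ k ∈ Finset.range (n + 1), δ / 2 * (2⁻¹) ^ (k + 1) :=
            Finset.sum_le_sum fun k _ => (hψg k).le
        _ ≤ δ / 2 := by
          have : ∀ N : ℕ, ∑ k ∈ Finset.range N, δ / 2 * (2⁻¹ : ℝ) ^ (k + 1)
              = δ / 2 * (1 - (2⁻¹) ^ N) := by
            intro N
            induction N with
            | zero => simp
            | succ N ih => rw [Finset.sum_range_succ, ih]; ring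
          rw [this]
          have : (0 : ℝ) ≤ 2⁻¹ ^ (n + 1) := by positivity
          nlinarith
    calc δ / 2 ≤ g s - g s' := by linarith
      _ = g (s - s') := (map_sub g s s').symm
      _ ≤ ‖s - s'‖ := hg1 _ (sub_nonneg.2 hss')
  choose next hnext using hstep
  obtain ⟨s₀, hs₀, -⟩ := hF.exists_tendsto_partialSups (w := w ∘ φ₀) fun n => hu _
  let t : ℕ → D := fun n => next^[n] ⟨s₀, φ₀, hφ₀, hφ₀δ, hs₀⟩
  have ht : ∀ n, t (n + 1) = next (t n) := fun n => Function.iterate_succ_apply' _ _ _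
  have hmono : Monotone fun n => -(t n).1 := monotone_nat_of_le_succ fun n => by
    rw [ht]; exact neg_le_neg (hnext _).1
  have hc := hF.cauchySeq_of_monotone hmono (u := 0) fun n => by
    obtain ⟨φ, -, -, h⟩ := (t n).2
    exact neg_nonpos.2 ((hw (φ 0)).trans (h.1 ⟨0, rfl⟩))
  obtain ⟨N, hN⟩ := Metric.cauchySeq_iff'.1 hc (δ / 2) (half_pos hδ)
  have h1 := hN (N + 1) (by omega)
  have h2 := (hnext (t N)).2
  rw [← ht] at h2
  rw [dist_eq_norm, neg_sub_neg] at h1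
  linarith

/-- Positive weakly null sequences with L-weakly compact range are norm null. -/
theorem HasOrderContinuousNorm.tendsto_norm_of_isLWeaklyCompact (hF : HasOrderContinuousNorm F)
    {z : ℕ → F} (hz : ∀ n, 0 ≤ z n) (hL : IsLWeaklyCompact (range z))
    (hnull : ∀ g : F →L[ℝ] ℝ, (∀ x, 0 ≤ x → 0 ≤ g x) → Tendsto (fun n => g (z n)) atTop (𝓝 0)) :
    Tendsto (fun n => ‖z n‖) atTop (𝓝 0) := by
  obtain ⟨C, hC⟩ := hL.1.exists_norm_le
  rw [Metric.tendsto_atTop]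
  intro ε hε
  obtain ⟨u, hu0, hu⟩ := exists_norm_map_posPart_sub_le (A := range z)
    (by rintro _ ⟨n, rfl⟩; exact hz n) hC (ContinuousLinearMap.id ℝ F) (fun x hx => hx)
    (fun v hv hvA hdis => hL.2 v
      (fun n => by
        obtain ⟨a, ha, hva⟩ := hvA n
        exact ⟨a, ha, by rw [abs_of_nonneg (hv n)]; exact hva.trans (le_abs_self a)⟩)
      (fun m n hmn => by rw [abs_of_nonneg (hv m), abs_of_nonneg (hv n)]; exact hdis m n hmn))
    (half_pos hε)
  have hinf : Tendsto (fun n => ‖z n ⊓ u‖) atTop (𝓝 0) :=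
    hF.tendsto_norm_of_weaklyNull (fun n => le_inf (hz n) hu0) (fun n => inf_le_right)
      fun g hg => squeeze_zero (fun n => hg _ (le_inf (hz n) hu0))
        (fun n => map_mono_of_nonneg g hg inf_le_left) (hnull g hg)
  obtain ⟨N, hN⟩ := Metric.tendsto_atTop.1 hinf (ε / 2) (half_pos hε)
  refine ⟨N, fun n hn => ?_⟩
  have h1 := hN n hn
  have h2 := hu _ ⟨n, rfl⟩
  have h3 := norm_add_le (z n ⊓ u) (z n - u)⁺
  rw [← eq_inf_add_posPart_sub] at h3
  rw [dist_zero_right, norm_norm] at h1 ⊢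
  simp only [ContinuousLinearMap.id_apply] at h2
  linarith

end OrderContinuous

/-! ### Weakly null sequences -/

section Weak

variable {X : Type u} [NormedAddCommGroup X] [NormedSpace ℝ X]

theorem tendsto_toWeakSpace_iff {ι : Type*} {l : Filter ι} {x : ι → X} {a : X} :
    Tendsto (fun i => toWeakSpace ℝ X (x i)) l (𝓝 (toWeakSpace ℝ X a)) ↔
      ∀ h : X →L[ℝ] ℝ, Tendsto (fun i => h (x i)) l (𝓝 (h a)) := by
  have hB : Function.Injective (topDualPairing ℝ X).flip := fun x y hxy => by
    by_contra hne
    obtain ⟨f, hf⟩ := SeparatingDual.exists_separating_of_ne (R := ℝ) hne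
    exact hf (DFunLike.congr_fun hxy f)
  exact WeakBilin.tendsto_iff_forall_eval_tendsto _ hB

theorem continuous_apply_toWeakSpace_symm (h : X →L[ℝ] ℝ) :
    Continuous fun x : WeakSpace ℝ X => h ((toWeakSpace ℝ X).symm x) :=
  continuous_iff_continuousAt.2 fun x =>
    (tendsto_toWeakSpace_iff (x := (toWeakSpace ℝ X).symm)
      (a := (toWeakSpace ℝ X).symm x)).1 tendsto_id h

theorem isRelativelyWeaklyCompact_range_of_weaklyNull {x : ℕ → X}
    (hx : ∀ h : X →L[ℝ] ℝ, Tendsto (fun n => h (x n)) atTop (𝓝 0)) :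
    IsRelativelyWeaklyCompact (range x) := by
  have hlim : Tendsto (fun n => toWeakSpace ℝ X (x n)) atTop (𝓝 (toWeakSpace ℝ X 0)) :=
    tendsto_toWeakSpace_iff.2 fun h => by simpa using hx h
  have hK := hlim.isCompact_insert_range
  refine hK.of_isClosed_subset isClosed_closure (closure_minimal ?_ hK.isClosed)
  rintro _ ⟨_, ⟨n, rfl⟩, rfl⟩
  exact mem_insert_of_mem _ ⟨n, rfl⟩

end Weak

/-! ### Order continuity of the dual norm -/

section DualNorm

variable {E : Type u} [NormedAddCommGroup E] [NormedSpace ℝ E] [Lattice E]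
  [IsOrderedAddMonoid E] [IsOrderedModule ℝ E] [HasSolidNorm E]

/-- If the dual norm is order continuous, bounded disjoint sequences are null for every positive
functional `f`: the partial sums of the components of `f` along the sequence converge in norm. -/
theorem DualHasOrderContinuousNorm.tendsto_of_disjoint (hE : DualHasOrderContinuousNorm E)
    {f : E →L[ℝ] ℝ} (hf : ∀ x, 0 ≤ x → 0 ≤ f x) {s : ℕ → E} (hs : ∀ n, 0 ≤ s n)
    (hdis : ∀ m n, m ≠ n → s m ⊓ s n = 0) {C : ℝ} (hC : ∀ n, ‖s n‖ ≤ C) :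
    Tendsto (fun n => f (s n)) atTop (𝓝 0) := by
  obtain ⟨φ, hφ0, hφf, hφs, -⟩ := exists_disjoint_components f hf hs hdis
  obtain ⟨G, hG⟩ := exists_clm_hasSum (sum_abs_le_of_sum_le hφ0 hφf) (y := fun _ => (1 : ℝ))
    (fun _ => by simp)
  simp only [smul_eq_mul, mul_one] at hG
  -- `r N` is the `N`-th remainder of the series of components; it decreases to `0`.
  let r : ℕ → StrongDual ℝ E := fun N => G - ∑ n ∈ Finset.range N, φ n
  have hr : ∀ N x, r N x = G x - ∑ n ∈ Finset.range N, φ n x := fun N x => by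
    simp [r]
  have hrs : ∀ N, r N = φ N + r (N + 1) := fun N => by
    simp only [r, Finset.sum_range_succ]; abel
  have hr0 : ∀ N x, 0 ≤ x → 0 ≤ r N x := fun N x hx => by
    rw [hr, sub_nonneg]
    exact sum_le_hasSum _ (fun n _ => hφ0 n x hx) (hG x)
  have hrlim : ∀ x, Tendsto (fun N => r N x) atTop (𝓝 0) := fun x => by
    have := (hG x).tendsto_sum_nat.const_sub (G x)
    rw [sub_self] at this
    exact this.congr fun N => (hr N x).symm
  have hrm : ∀ N M, N ≤ M → ∀ x, 0 ≤ x → r M x ≤ r N x := fun N M hNM x hx => by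
    rw [hr, hr]
    exact sub_le_sub_left (Finset.sum_le_sum_of_subset_of_nonneg
      (Finset.range_mono hNM) fun n _ _ => hφ0 n x hx) _
  have hnorm : Tendsto (fun N => ‖r N‖) atTop (𝓝 0) := by
    let := dualOrder E
    have h := hE (ULift.{u} ℕ) (fun i => r i.down) (fun i j hij => hrm _ _ hij) ⟨?_, ?_⟩
    · have hup : Tendsto (ULift.up.{u} : ℕ → ULift ℕ) atTop atTop :=
        tendsto_atTop.2 fun i => (eventually_ge_atTop i.down).mono fun n hn => hn
      exact h.comp hup
    · rintro _ ⟨i, rfl⟩ x hx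
      exact hr0 _ x hx
    · intro l hl x hx
      exact ge_of_tendsto' (hrlim x) fun N => hl ⟨⟨N⟩, rfl⟩ x hx
  have hC0 : 0 ≤ C := (norm_nonneg _).trans (hC 0)
  refine squeeze_zero (fun n => hf _ (hs n)) (fun n => ?_) (by simpa using hnorm.mul_const C)
  calc f (s n) = φ n (s n) := (hφs n).symm
    _ ≤ r n (s n) := by
      rw [hrs n]
      exact le_add_of_nonneg_right (hr0 _ _ (hs n))
    _ ≤ ‖r n‖ * ‖s n‖ := (le_abs_self _).trans ((r n).le_opNorm _)
    _ ≤ ‖r n‖ * C := mul_le_mul_of_nonneg_left (hC n) (norm_nonneg _)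

/-- Converse of `DualHasOrderContinuousNorm.tendsto_of_disjoint`: by
`exists_norm_map_posPart_sub_le`, applied to a member of a net decreasing to `0`, norm convergence
of the net reduces to its convergence at a single element. -/
theorem dualHasOrderContinuousNorm_of_forall_disjoint [CompleteSpace E]
    (h : ∀ f : E →L[ℝ] ℝ, (∀ x, 0 ≤ x → 0 ≤ f x) → ∀ s : ℕ → E, (∀ n, 0 ≤ s n) →
      (∀ n, ‖s n‖ ≤ 1) → (∀ m n, m ≠ n → s m ⊓ s n = 0) →
      Tendsto (fun n => f (s n)) atTop (𝓝 0)) : DualHasOrderContinuousNorm E := by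
  let := dualOrder E
  intro ι _ _ _ g hanti hglb
  have hg0 : ∀ i x, 0 ≤ x → 0 ≤ g i x := fun i => hglb.1 ⟨i, rfl⟩
  have hgm : ∀ {i j}, i ≤ j → ∀ x, 0 ≤ x → g j x ≤ g i x := fun hij => hanti hij
  have hbdd : ∀ x, 0 ≤ x → BddBelow (range fun i => g i x) := fun x hx =>
    ⟨0, by rintro _ ⟨i, rfl⟩; exact hg0 i x hx⟩
  have hlim : ∀ x, 0 ≤ x → Tendsto (fun i => g i x) atTop (𝓝 (⨅ i, g i x)) := fun x hx =>
    tendsto_atTop_ciInf (fun i j hij => hgm hij x hx) (hbdd x hx)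
  obtain ⟨i₀⟩ := ‹Nonempty ι›
  have : Nonempty ι := ⟨i₀⟩
  obtain ⟨l, hl⟩ := exists_clm_eq_of_additive (fun x => ⨅ i, g i x)
    (fun x y hx hy => tendsto_nhds_unique (hlim _ (add_nonneg hx hy))
      (((hlim x hx).add (hlim y hy)).congr fun i => (map_add (g i) x y).symm))
    (fun x hx => le_ciInf fun i => hg0 i x hx) (norm_nonneg (g i₀))
    (fun x hx => (ciInf_le (hbdd x hx) i₀).trans ((le_abs_self _).trans ((g i₀).le_opNorm x)))
  have hl0 : ∀ x, 0 ≤ x → l x ≤ 0 := hglb.2 (by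
    rintro _ ⟨i, rfl⟩ x hx
    rw [hl x hx]
    exact ciInf_le (hbdd x hx) i)
  have hpt : ∀ x, 0 ≤ x → Tendsto (fun i => g i x) atTop (𝓝 0) := fun x hx => by
    have h0 : (⨅ i, g i x) = 0 :=
      le_antisymm ((hl x hx).symm.le.trans (hl0 x hx)) (le_ciInf fun i => hg0 i x hx)
    rw [← h0]
    exact hlim x hx
  rw [Metric.tendsto_nhds]
  intro ε hε
  obtain ⟨u, hu0, hu⟩ := exists_norm_map_posPart_sub_le (A := {x : E | 0 ≤ x ∧ ‖x‖ ≤ 1})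
    (fun a ha => ha.1) (fun a ha => ha.2) (g i₀) (hg0 i₀) (fun v hv hvA hdis => by
      simpa using (h (g i₀) (hg0 i₀) v hv (fun n => by
        obtain ⟨a, ha, hva⟩ := hvA n
        exact (norm_le_norm_of_nonneg_of_le (hv n) hva).trans ha.2) hdis).norm)
    (half_pos hε)
  filter_upwards [(hpt u hu0).eventually (gt_mem_nhds (half_pos hε)), eventually_ge_atTop i₀]
    with i hi hii
  rw [dist_zero_right, norm_norm]
  refine lt_of_le_of_lt (ContinuousLinearMap.opNorm_le_of_unit_norm (C := g i u + ε / 2)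
    (add_nonneg (hg0 i u hu0) (half_pos hε).le) fun x hx => ?_) (by linarith)
  calc ‖g i x‖ ≤ g i |x| := abs_map_le (g i) (hg0 i) x
    _ = g i (|x| ⊓ u) + g i (|x| - u)⁺ := by rw [← map_add, ← eq_inf_add_posPart_sub]
    _ ≤ g i u + ε / 2 := add_le_add (map_mono_of_nonneg (g i) (hg0 i) inf_le_right)
        ((hgm hii _ (posPart_nonneg _)).trans ((le_abs_self _).trans
          (hu |x| ⟨abs_nonneg x, by rw [norm_abs_eq_norm, hx]⟩)))

end DualNorm

/-! ### Semi-compact operators -/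

section SemiCompact

variable {E : Type u} [NormedAddCommGroup E] [NormedSpace ℝ E] [Lattice E]
  [IsOrderedAddMonoid E] [IsOrderedModule ℝ E] [HasSolidNorm E]
  {F : Type v} [NormedAddCommGroup F] [NormedSpace ℝ F] [Lattice F]
  [IsOrderedAddMonoid F] [IsOrderedModule ℝ F] [HasSolidNorm F]

omit [IsOrderedModule ℝ F] [HasSolidNorm F] in
theorem isSemiCompact_iff {X : Type u} [NormedAddCommGroup X] [NormedSpace ℝ X] (T : X →L[ℝ] F) :
    IsSemiCompact T ↔ ∀ ε : ℝ, 0 < ε → ∃ u : F, 0 ≤ u ∧ ∀ x, ‖x‖ ≤ 1 →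
      ∃ a, |a| ≤ u ∧ ‖T x - a‖ ≤ ε := by
  refine forall₂_congr fun ε hε => exists_congr fun u => and_congr_right fun _ => ?_
  rw [image_subset_iff]
  refine forall_congr' fun x => ?_
  rw [mem_closedBall_zero_iff, mem_preimage, Set.mem_add, smul_closedBall _ _ zero_le_one]
  refine imp_congr_right fun _ => ⟨?_, ?_⟩
  · rintro ⟨a, ha, b, hb, hab⟩
    refine ⟨a, sup_le ha.2 (neg_le.1 ha.1), ?_⟩
    rw [← hab, add_sub_cancel_left]
    simpa [abs_of_pos hε] using hb
  · rintro ⟨a, ha, hb⟩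
    refine ⟨a, ⟨neg_le.1 ((neg_le_abs a).trans ha), (le_abs_self a).trans ha⟩, T x - a, ?_,
      add_sub_cancel _ _⟩
    simpa [abs_of_pos hε] using hb

omit [HasSolidNorm F] in
theorem isSemiCompact_of_finiteDimensional_codomain {X : Type u} [NormedAddCommGroup X]
    [NormedSpace ℝ X] [FiniteDimensional ℝ F] (T : X →L[ℝ] F) : IsSemiCompact T := by
  obtain ⟨u, hu0, hu⟩ := exists_abs_le_smul_of_finiteDimensional (E := F)
  refine (isSemiCompact_iff T).2 fun ε hε => ⟨‖T‖ • u, smul_nonneg (norm_nonneg T) hu0,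
    fun x hx => ⟨T x, (hu _).trans (smul_le_smul_of_nonneg_right ?_ hu0), by simpa using hε.le⟩⟩
  exact (T.le_opNorm x).trans (mul_le_of_le_one_right (norm_nonneg T) hx)

omit [HasSolidNorm E] [IsOrderedModule ℝ F] [HasSolidNorm F] in
theorem isSemiCompact_of_finiteDimensional_domain [FiniteDimensional ℝ E] (T : E →L[ℝ] F)
    (hT : ∀ x, 0 ≤ x → 0 ≤ T x) : IsSemiCompact T := by
  obtain ⟨u, hu0, hu⟩ := exists_abs_le_smul_of_finiteDimensional (E := E)
  refine (isSemiCompact_iff T).2 fun ε hε => ⟨T u, hT u hu0, fun x hx => ⟨T x, ?_,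
    by simpa using hε.le⟩⟩
  refine (abs_map_le T hT x).trans (map_mono_of_nonneg T hT ((hu x).trans ?_))
  simpa using smul_le_smul_of_nonneg_right hx hu0

/-- Bounded disjoint sequences of `E` are weakly null, so that a positive almost L-weakly compact
operator maps them to norm null sequences. -/
theorem IsAlmostLWeaklyCompact.isSemiCompact [CompleteSpace E] [CompleteSpace F]
    (hE : DualHasOrderContinuousNorm E) (hF : HasOrderContinuousNorm F) {T : E →L[ℝ] F}
    (hTL : IsAlmostLWeaklyCompact T) (hT : ∀ x, 0 ≤ x → 0 ≤ T x) : IsSemiCompact T := by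
  have hdisj : ∀ v : ℕ → E, (∀ n, 0 ≤ v n) → (∀ n, ∃ a ∈ {x : E | 0 ≤ x ∧ ‖x‖ ≤ 1}, v n ≤ a) →
      (∀ m n, m ≠ n → v m ⊓ v n = 0) → Tendsto (fun n => ‖T (v n)‖) atTop (𝓝 0) := by
    intro v hv hvA hdis
    have hv1 : ∀ n, ‖v n‖ ≤ 1 := fun n => by
      obtain ⟨a, ha, hva⟩ := hvA n
      exact (norm_le_norm_of_nonneg_of_le (hv n) hva).trans ha.2
    have hpos : ∀ f : E →L[ℝ] ℝ, (∀ x, 0 ≤ x → 0 ≤ f x) →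
        Tendsto (fun n => f (v n)) atTop (𝓝 0) := fun f hf =>
      hE.tendsto_of_disjoint hf hv hdis hv1
    have hweak : ∀ h : E →L[ℝ] ℝ, Tendsto (fun n => h (v n)) atTop (𝓝 0) := fun h => by
      obtain ⟨g, hg⟩ := exists_nonneg_majorant h
      have h1 := hpos g fun x hx => (hg x hx).1
      have h2 := hpos (g - h) fun x hx => sub_nonneg.2 (hg x hx).2.1
      simpa using h1.sub h2
    have hL := hTL _ (isRelativelyWeaklyCompact_range_of_weaklyNull hweak)
    rw [← range_comp] at hL
    exact hF.tendsto_norm_of_isLWeaklyCompact (fun n => hT _ (hv n)) hL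
      fun g hg => hpos (g.comp T) fun x hx => hg _ (hT x hx)
  refine (isSemiCompact_iff T).2 fun ε hε => ?_
  obtain ⟨u, hu0, hu⟩ := exists_norm_map_posPart_sub_le (fun a ha => ha.1) (fun a ha => ha.2)
    T hT hdisj (half_pos hε)
  refine ⟨T u, hT u hu0, fun x hx => ⟨T (x⁺ ⊓ u - x⁻ ⊓ u), ?_, ?_⟩⟩
  · refine (abs_map_le T hT _).trans (map_mono_of_nonneg T hT (sup_le ?_ ?_))
    · exact (sub_le_self _ (le_inf (negPart_nonneg x) hu0)).trans inf_le_right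
    · rw [neg_sub]
      exact (sub_le_self _ (le_inf (posPart_nonneg x) hu0)).trans inf_le_right
  · have hx' : x - (x⁺ ⊓ u - x⁻ ⊓ u) = (x⁺ - u)⁺ - (x⁻ - u)⁺ := by
      rw [inf_eq_sub_posPart_sub x⁺, inf_eq_sub_posPart_sub x⁻]
      nth_rewrite 1 [← posPart_sub_negPart x]
      abel
    rw [← map_sub, hx', map_sub]
    have h1 := hu x⁺ ⟨posPart_nonneg x, (norm_posPart_le x).trans hx⟩
    have h2 := hu x⁻ ⟨negPart_nonneg x, (norm_negPart_le x).trans hx⟩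
    exact (norm_sub_le _ _).trans (by linarith)

end SemiCompact

/-! ### The Schur property -/

section Schur

variable {X : Type u} [NormedAddCommGroup X] [NormedSpace ℝ X]

/-- The Schur property of `ℓ¹`, for the map `x ↦ (φ n x)` into `ℓ¹`: on relatively weakly compact
sets the tails of `∑ |φ n x|` are uniformly small. -/
theorem IsRelativelyWeaklyCompact.exists_sum_Ico_abs_le {A : Set X}
    (hA : IsRelativelyWeaklyCompact A) {φ : ℕ → X →L[ℝ] ℝ} {C : ℝ}
    (hφ : ∀ x N, ∑ n ∈ Finset.range N, |φ n x| ≤ C * ‖x‖) {ε : ℝ} (hε : 0 < ε) :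
    ∃ N, ∀ a ∈ A, ∀ M, ∑ n ∈ Finset.Ico N M, |φ n a| ≤ ε := by
  by_contra! hcon
  choose a haA M haM using hcon
  have hsa : ∀ x, Summable fun n => |φ n x| := fun x =>
    summable_of_sum_range_le (fun n => abs_nonneg _) (hφ x)
  have haK : ∀ n, toWeakSpace ℝ X (a n) ∈ closure (toWeakSpace ℝ X '' A) := fun n =>
    subset_closure ⟨a n, haA n, rfl⟩
  -- A subsequence of `a` converges coordinatewise, the product `ℕ → ℝ` being metrizable.
  have hπ : Continuous fun (x : WeakSpace ℝ X) n => φ n ((toWeakSpace ℝ X).symm x) :=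
    continuous_pi fun n => continuous_apply_toWeakSpace_symm (φ n)
  obtain ⟨_, ⟨c, -, rfl⟩, j, hj, hjc⟩ := (hA.image hπ).tendsto_subseq
    (x := fun k n => φ n (a k)) fun k => ⟨_, haK k, rfl⟩
  obtain ⟨c, rfl⟩ := (toWeakSpace ℝ X).surjective c
  have hjc' : ∀ n, Tendsto (fun k => φ n (a (j k))) atTop (𝓝 (φ n c)) := fun n =>
    (tendsto_pi_nhds.1 hjc) n
  let Z := ℕ → Icc (-1 : ℝ) 1
  have : Nonempty Z := ⟨fun _ => ⟨0, by norm_num⟩⟩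
  have hz1 : ∀ (z : Z) n, ‖(z n : ℝ)‖ ≤ 1 := fun z n => abs_le.2 (z n).2
  choose Φ hΦ using fun z : Z => exists_clm_hasSum hφ (hz1 z)
  -- By compactness every `Φ z` converges along the subsequence: all weak cluster points have
  -- the coordinates of `c`.
  have hΦlim : ∀ z, Tendsto (fun k => Φ z (a (j k) - c)) atTop (𝓝 0) := by
    intro z
    have : Tendsto (fun k => Φ z (a (j k))) atTop (𝓝 (Φ z c)) := by
      rw [tendsto_iff_ultrafilter]
      intro U hU
      obtain ⟨c', -, hc'⟩ := hA.ultrafilter_le_nhds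
        (U.map fun k => toWeakSpace ℝ X (a (j k)))
        (tendsto_principal.2 (Eventually.of_forall fun k => haK (j k)))
      obtain ⟨c', rfl⟩ := (toWeakSpace ℝ X).surjective c'
      have hlim := tendsto_toWeakSpace_iff.1 (show Tendsto (fun k => toWeakSpace ℝ X (a (j k)))
        U (𝓝 (toWeakSpace ℝ X c')) from hc')
      have hcc : ∀ n, φ n c' = φ n c := fun n =>
        tendsto_nhds_unique (hlim (φ n)) ((hjc' n).mono_left hU)
      have hΦc : Φ z c' = Φ z c := (hΦ z c').unique (by simpa only [hcc] using hΦ z c)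
      rw [← hΦc]
      exact hlim (Φ z)
    simpa using this.sub_const (Φ z c)
  have hcont : ∀ x, Continuous fun z : Z => Φ z x := by
    intro x
    have h1 : (fun z : Z => Φ z x) = fun z => ∑' n, φ n x • (z n : ℝ) :=
      funext fun z => (hΦ z x).tsum_eq.symm
    rw [h1]
    refine continuous_tsum (fun n => ?_) (hsa x) fun n z => ?_
    · have hn : Continuous fun z : Z => (z n : ℝ) :=
        continuous_subtype_val.comp (continuous_apply (A := fun _ : ℕ => Icc (-1 : ℝ) 1) n)
      exact hn.const_smul (φ n x)
    · rw [norm_smul]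
      exact mul_le_of_le_one_right (norm_nonneg _) (hz1 z n)
  -- Baire category on the compact space `Z`: for some `m` the bound `ε / 4` holds for all `k ≥ m`
  -- and all `z` that agree with a certain `z₀` on a finite set `I` of coordinates.
  obtain ⟨m, z₀, hz₀⟩ := nonempty_interior_of_iUnion_of_closed
    (f := fun m : ℕ => {z : Z | ∀ k, m ≤ k → |Φ z (a (j k) - c)| ≤ ε / 4})
    (fun m => by
      simp only [ofPred_forall]
      exact isClosed_iInter fun k => isClosed_iInter fun _ =>
        isClosed_le (hcont _).abs continuous_const)
    (by
      refine eq_univ_of_forall fun z => mem_iUnion.2 ?_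
      obtain ⟨m, hm⟩ := Metric.tendsto_atTop.1 (hΦlim z) (ε / 4) (by positivity)
      exact ⟨m, fun k hk => by simpa using (hm k hk).le⟩)
  obtain ⟨I, V, hV, hIV⟩ := isOpen_pi_iff.1 isOpen_interior z₀ hz₀
  have hmem : ∀ z : Z, (∀ n ∈ I, z n = z₀ n) → ∀ k, m ≤ k → |Φ z (a (j k) - c)| ≤ ε / 4 := by
    intro z hz
    have : z ∈ (I : Set ℕ).pi V := fun n hn => by rw [hz n hn]; exact (hV n hn).2
    exact interior_subset (hIV this)
  obtain ⟨I', hI'⟩ := summable_iff_vanishing_norm.1 (hsa c) (ε / 2) (half_pos hε)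
  obtain ⟨N, hN⟩ := (I ∪ I').exists_nat_subset_range
  let k := max m N
  have hNk : N ≤ j k := (le_max_right m N).trans (hj.id_le k)
  have hout : ∀ n ∈ Finset.Ico (j k) (M (j k)), n ∉ I ∪ I' := fun n hn h => by
    have h1 := Finset.mem_range.1 (hN h)
    have h2 := (Finset.mem_Ico.1 hn).1
    omega
  set b := a (j k) - c with hb
  -- Two sign sequences that agree with `z₀` outside the block and are opposite on it.
  let sgn : Z := fun n => ⟨SignType.sign (φ n b), by
    rcases lt_trichotomy (φ n b) 0 with h | h | h <;> simp [h]⟩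
  let z : Z := fun n => if n ∈ Finset.Ico (j k) (M (j k)) then sgn n else z₀ n
  let z' : Z := fun n => if n ∈ Finset.Ico (j k) (M (j k)) then
    ⟨-(sgn n : ℝ), by have := (sgn n).2; constructor <;> linarith [this.1, this.2]⟩ else z₀ n
  have hz := hmem z (fun n hn => if_neg fun h => hout n h (Finset.mem_union_left _ hn)) k
    (le_max_left _ _)
  have hz' := hmem z' (fun n hn => if_neg fun h => hout n h (Finset.mem_union_left _ hn)) k
    (le_max_left _ _)
  have hdiff : Φ z b - Φ z' b = ∑ n ∈ Finset.Ico (j k) (M (j k)), 2 * |φ n b| := by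
    refine ((hΦ z b).sub (hΦ z' b)).unique ?_
    have h1 : ∀ n ∈ Finset.Ico (j k) (M (j k)),
        φ n b • (z n : ℝ) - φ n b • (z' n : ℝ) = 2 * |φ n b| := fun n hn => by
      simp only [z, z', if_pos hn, sgn, smul_eq_mul, mul_neg, sub_neg_eq_add]
      rw [mul_comm, sign_mul_self]
      ring
    rw [← Finset.sum_congr rfl h1]
    exact hasSum_sum_of_ne_finset_zero fun n hn => by simp only [z, z', if_neg hn, sub_self]
  rw [← Finset.mul_sum] at hdiff
  have h1 := haM (j k)
  have h2 := hI' (Finset.Ico (j k) (M (j k))) (Finset.disjoint_left.2 fun n hn h =>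
    hout n hn (Finset.mem_union_right _ h))
  rw [Real.norm_of_nonneg (Finset.sum_nonneg fun n _ => abs_nonneg _)] at h2
  have h3 : ∑ n ∈ Finset.Ico (j k) (M (j k)), |φ n (a (j k))| ≤
      ∑ n ∈ Finset.Ico (j k) (M (j k)), |φ n b| + ∑ n ∈ Finset.Ico (j k) (M (j k)), |φ n c| := by
    rw [← Finset.sum_add_distrib]
    refine Finset.sum_le_sum fun n _ => ?_
    have := abs_add_le (φ n b) (φ n c)
    rwa [← map_add, hb, sub_add_cancel] at this
  have h4 := abs_le.1 hz
  have h5 := abs_le.1 hz'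
  rw [← hb] at h4 h5
  linarith [h4.2, h5.1]

end Schur

/-! ### Almost order bounded sets and operators through `ℓ¹` -/

section LWeaklyCompact

variable {F : Type v} [NormedAddCommGroup F] [NormedSpace ℝ F] [Lattice F]
  [IsOrderedAddMonoid F] [IsOrderedModule ℝ F] [HasSolidNorm F]

/-- When the norm is order continuous, almost order bounded sets are L-weakly compact. -/
theorem HasOrderContinuousNorm.isLWeaklyCompact (hF : HasOrderContinuousNorm F) {A : Set F}
    (hA : ∀ ε : ℝ, 0 < ε → ∃ u : F, 0 ≤ u ∧ ∀ a ∈ A, ∃ b, |b| ≤ u ∧ ‖a - b‖ ≤ ε) :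
    IsLWeaklyCompact A := by
  constructor
  · obtain ⟨u, hu0, hu⟩ := hA 1 one_pos
    refine isBounded_iff_forall_norm_le.2 ⟨‖u‖ + 1, fun a ha => ?_⟩
    obtain ⟨b, hbu, hab⟩ := hu a ha
    have h1 : ‖b‖ ≤ ‖u‖ := norm_le_norm_of_abs_le_abs (by rwa [abs_of_nonneg hu0])
    have h2 := norm_add_le b (a - b)
    rw [add_sub_cancel] at h2
    linarith
  · intro y hy hdis
    rw [Metric.tendsto_atTop]
    intro ε hε
    obtain ⟨u, hu0, hu⟩ := hA (ε / 2) (half_pos hε)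
    have hinf := hF.tendsto_norm_of_disjoint (d := fun n => |y n| ⊓ u)
      (fun n => le_inf (abs_nonneg _) hu0)
      (fun m n hmn => inf_eq_zero_mono (le_inf (abs_nonneg _) hu0) (le_inf (abs_nonneg _) hu0)
        inf_le_left inf_le_left (hdis m n hmn)) (fun n => inf_le_right)
    obtain ⟨N, hN⟩ := Metric.tendsto_atTop.1 hinf (ε / 2) (half_pos hε)
    refine ⟨N, fun n hn => ?_⟩
    obtain ⟨a, ha, hya⟩ := hy n
    obtain ⟨b, hbu, hab⟩ := hu a ha
    have h1 : |y n| ≤ u + |a - b| := by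
      have := abs_add_le b (a - b)
      rw [add_sub_cancel] at this
      exact hya.trans (this.trans (add_le_add_left hbu _))
    have h2 := norm_le_norm_of_nonneg_of_le (abs_nonneg (y n))
      (le_inf_add_of_le_add (abs_nonneg (a - b)) h1)
    have h3 := norm_add_le (|y n| ⊓ u) |a - b|
    have h4 := hN n hn
    rw [norm_abs_eq_norm] at h2 h3
    rw [dist_zero_right, norm_norm] at h4 ⊢
    linarith

/-- Operators `x ↦ ∑ φ n x • y n`, which factor through `ℓ¹`, are almost L-weakly compact: by the
Schur property the images of relatively weakly compact sets are almost order bounded. -/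
theorem HasOrderContinuousNorm.isAlmostLWeaklyCompact_of_hasSum (hF : HasOrderContinuousNorm F)
    {X : Type u} [NormedAddCommGroup X] [NormedSpace ℝ X] {φ : ℕ → X →L[ℝ] ℝ} {C : ℝ}
    (hφ : ∀ x N, ∑ n ∈ Finset.range N, |φ n x| ≤ C * ‖x‖) {y : ℕ → F} (hy0 : ∀ n, 0 ≤ y n)
    (hy : ∀ n, ‖y n‖ ≤ 1) {T : X →L[ℝ] F} (hT : ∀ x, HasSum (fun n => φ n x • y n) (T x)) :
    IsAlmostLWeaklyCompact T := by
  intro A hA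
  have hbound : ∀ n, ∃ B : ℝ, 0 ≤ B ∧ ∀ a ∈ A, |φ n a| ≤ B := by
    intro n
    obtain ⟨B, hB⟩ := hA.exists_bound_of_continuousOn
      (continuous_apply_toWeakSpace_symm (φ n)).continuousOn
    exact ⟨|B|, abs_nonneg B, fun a ha =>
      (hB _ (subset_closure ⟨a, ha, rfl⟩)).trans (le_abs_self B)⟩
  choose B hB0 hB using hbound
  refine hF.isLWeaklyCompact fun ε hε => ?_
  obtain ⟨N, hN⟩ := hA.exists_sum_Ico_abs_le hφ hε
  refine ⟨∑ n ∈ Finset.range N, B n • y n, Finset.sum_nonneg fun n _ =>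
    smul_nonneg (hB0 n) (hy0 n), ?_⟩
  rintro _ ⟨a, ha, rfl⟩
  refine ⟨∑ n ∈ Finset.range N, φ n a • y n, (abs_sum_le _ _).trans
    (Finset.sum_le_sum fun n _ => (abs_smul_le _ _).trans ?_), ?_⟩
  · rw [abs_of_nonneg (hy0 n)]
    exact smul_le_smul_of_nonneg_right (hB n a ha) (hy0 n)
  · refine le_of_tendsto ((hT a).tendsto_sum_nat.sub_const _).norm ?_
    filter_upwards [eventually_ge_atTop N] with M hM
    rw [← Finset.sum_Ico_eq_sub _ hM]
    refine (norm_sum_le _ _).trans ((Finset.sum_le_sum fun n _ => ?_).trans (hN a ha M))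
    rw [norm_smul]
    exact mul_le_of_le_one_right (norm_nonneg _) (hy n)

end LWeaklyCompact

/-! ### Disjoint sequences in infinite-dimensional normed lattices -/

section Atoms

variable {F : Type*} [NormedAddCommGroup F] [Lattice F]

/-- A positive element `a ≠ 0` such that `[0, a]` does not contain two nonzero disjoint elements. -/
def IsDisjointnessAtom (a : F) : Prop :=
  0 < a ∧ ∀ b c, 0 ≤ b → b ≤ a → 0 ≤ c → c ≤ a → b ⊓ c = 0 → b = 0 ∨ c = 0

variable [NormedSpace ℝ F] [IsOrderedAddMonoid F] [IsOrderedModule ℝ F] [HasSolidNorm F]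

/-- Subtracting the largest multiple of an atom that fits below `r` leaves an element disjoint from
the atom. -/
theorem IsDisjointnessAtom.exists_inf_sub_smul_eq_zero {a : F} (ha : IsDisjointnessAtom a) {r : F}
    (hr : 0 ≤ r) : ∃ t : ℝ, 0 ≤ t ∧ t • a ≤ r ∧ a ⊓ (r - t • a) = 0 := by
  have ha0 := ha.1.le
  have hna : 0 < ‖a‖ := norm_pos_iff.2 ha.1.ne'
  let S := {t : ℝ | 0 ≤ t ∧ t • a ≤ r}
  have hSb : BddAbove S := ⟨‖r‖ / ‖a‖, fun t ht => by
    rw [le_div_iff₀ hna]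
    have := norm_le_norm_of_nonneg_of_le (smul_nonneg ht.1 ha0) ht.2
    rwa [norm_smul, Real.norm_of_nonneg ht.1] at this⟩
  have hSc : IsClosed S := (isClosed_le continuous_const continuous_id).inter
    (isClosed_le (continuous_id.smul continuous_const) continuous_const)
  have hmem : sSup S ∈ S := hSc.csSup_mem ⟨0, le_rfl, by simpa using hr⟩ hSb
  refine ⟨sSup S, hmem.1, hmem.2, ?_⟩
  set t := sSup S with ht
  set e := a ⊓ (r - t • a) with he
  have he0 : 0 ≤ e := le_inf ha0 (sub_nonneg.2 hmem.2)
  have hsmall : ∀ l : ℝ, 0 < l → l ≤ 1 → e ≤ l • a := by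
    intro l hl hl1
    have hla : l • a ≤ a := by
      simpa using smul_le_smul_of_nonneg_right hl1 ha0
    rcases ha.2 (e - l • a)⁺ (e - l • a)⁻ (posPart_nonneg _)
      ((posPart_sub_le_self he0 (smul_nonneg hl.le ha0)).trans inf_le_left) (negPart_nonneg _)
      (by
        rw [← posPart_neg, neg_sub]
        exact (posPart_sub_le_self (smul_nonneg hl.le ha0) he0).trans hla)
      (posPart_inf_negPart_eq_zero _) with h | h
    · exact sub_nonpos.1 (posPart_eq_zero.1 h)
    · have h1 : l • a ≤ r - t • a := (sub_nonneg.1 (negPart_eq_zero.1 h)).trans inf_le_right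
      have h2 : t + l ∈ S := ⟨add_nonneg hmem.1 hl.le, by
        rw [add_smul, ← le_sub_iff_add_le']; exact h1⟩
      have := le_csSup hSb h2
      linarith
  refine le_antisymm (nonpos_of_forall_nsmul_le (z := a) fun k => ?_) he0
  rcases Nat.eq_zero_or_pos k with rfl | hk
  · simpa using ha0
  · have hk' : (1 : ℝ) ≤ k := by exact_mod_cast hk
    have := smul_le_smul_of_nonneg_left
      (hsmall (k : ℝ)⁻¹ (by positivity) (inv_le_one_of_one_le₀ hk')) (zero_le_one.trans hk')
    rwa [smul_smul, mul_inv_cancel₀ (by positivity), one_smul] at this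

/-- Modulo the span of finitely many atoms, every positive element is a positive element disjoint
from all of them. -/
theorem exists_sub_mem_span_of_isDisjointnessAtom (s : Finset F)
    (hs : ∀ a ∈ s, IsDisjointnessAtom a) {x : F} (hx : 0 ≤ x) :
    ∃ r, 0 ≤ r ∧ x - r ∈ Submodule.span ℝ (s : Set F) ∧ ∀ a ∈ s, a ⊓ r = 0 := by
  classical
  induction s using Finset.induction_on with
  | empty => exact ⟨x, hx, by simp, by simp⟩
  | insert a s _ ih =>
    obtain ⟨r, hr0, hr, hrs⟩ := ih fun b hb => hs b (Finset.mem_insert_of_mem hb)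
    obtain ⟨t, ht0, htr, hta⟩ :=
      (hs a (Finset.mem_insert_self a s)).exists_inf_sub_smul_eq_zero hr0
    have hr' : 0 ≤ r - t • a := sub_nonneg.2 htr
    refine ⟨r - t • a, hr', ?_, fun b hb => ?_⟩
    · rw [sub_sub_eq_add_sub, add_sub_right_comm]
      refine Submodule.add_mem _ (Submodule.span_mono (by simp) hr)
        (Submodule.smul_mem _ t (Submodule.subset_span (by simp)))
    · rcases Finset.mem_insert.1 hb with rfl | hb'
      · exact hta
      · exact inf_eq_zero_mono (hs b hb).1.le hr' le_rfl
          (sub_le_self r (smul_nonneg ht0 (hs a (Finset.mem_insert_self a s)).1.le)) (hrs b hb')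

omit [NormedSpace ℝ F] [IsOrderedAddMonoid F] [IsOrderedModule ℝ F] [HasSolidNorm F] in
/-- An element with no atom below it can be split indefinitely. -/
theorem exists_disjoint_seq_of_no_atom {x : F} (hx : 0 < x)
    (h : ∀ a ≤ x, ¬ IsDisjointnessAtom a) :
    ∃ d : ℕ → F, (∀ n, 0 < d n) ∧ ∀ m n, m ≠ n → d m ⊓ d n = 0 := by
  let Y := {y : F // 0 < y ∧ y ≤ x}
  have hstep : ∀ y : Y, ∃ (y' : Y) (b : F), 0 < b ∧ b ≤ y.1 ∧ y'.1 ≤ y.1 ∧ b ⊓ y'.1 = 0 := by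
    rintro ⟨y, hy0, hyx⟩
    have hy := h y hyx
    simp only [IsDisjointnessAtom, not_and, not_forall, not_or] at hy
    obtain ⟨b, c, hb0, hby, hc0, hcy, hbc, hb, hc⟩ := hy hy0
    exact ⟨⟨c, lt_of_le_of_ne hc0 (Ne.symm hc), hcy.trans hyx⟩, b,
      lt_of_le_of_ne hb0 (Ne.symm hb), hby, hcy, hbc⟩
  choose next b hb0 hby hny hbn using hstep
  let t : ℕ → Y := fun n => next^[n] ⟨x, hx, le_rfl⟩
  have ht : ∀ n, t (n + 1) = next (t n) := fun n => Function.iterate_succ_apply' _ _ _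
  have hanti : Antitone fun n => (t n).1 := antitone_nat_of_succ_le fun n => by
    rw [ht]; exact hny _
  have hlt : ∀ m n, m < n → b (t m) ⊓ b (t n) = 0 := fun m n hmn => by
    refine inf_eq_zero_mono (hb0 _).le (hb0 _).le le_rfl ?_ (hbn (t m))
    rw [← ht]
    exact (hby _).trans (hanti (Nat.succ_le_of_lt hmn))
  refine ⟨fun n => b (t n), fun n => hb0 _, fun m n hmn => ?_⟩
  rcases lt_or_gt_of_ne hmn with h' | h'
  · exact hlt m n h'
  · rw [inf_comm]; exact hlt n m h'

/-- Either some positive element has no atom below it and can be split indefinitely, or atoms are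
abundant; then finitely many atoms, which do not span `F`, leave room for one disjoint from them. -/
theorem exists_disjoint_seq_of_not_finiteDimensional (hF : ¬ FiniteDimensional ℝ F) :
    ∃ d : ℕ → F, (∀ n, 0 < d n) ∧ ∀ m n, m ≠ n → d m ⊓ d n = 0 := by
  by_cases hat : ∀ x : F, 0 < x → ∃ a ≤ x, IsDisjointnessAtom a
  · have : Std.Symm fun a b : F => a ⊓ b = 0 := ⟨fun a b h => by rwa [inf_comm]⟩
    obtain ⟨d, hd, hdis⟩ := exists_seq_of_forall_finset_exists' (α := F) IsDisjointnessAtom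
      (fun a b => a ⊓ b = 0) fun s hs => by
        obtain ⟨x, hx0, hxs⟩ : ∃ x : F, 0 ≤ x ∧ x ∉ Submodule.span ℝ (s : Set F) := by
          by_contra! hcon
          refine hF ⟨⟨s, eq_top_iff.2 fun x _ => ?_⟩⟩
          rw [← posPart_sub_negPart x]
          exact Submodule.sub_mem _ (hcon _ (posPart_nonneg x)) (hcon _ (negPart_nonneg x))
        obtain ⟨r, hr0, hr, hrs⟩ := exists_sub_mem_span_of_isDisjointnessAtom s hs hx0
        have hrne : r ≠ 0 := by
          rintro rfl
          exact hxs (by simpa using hr)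
        obtain ⟨b, hbr, hb⟩ := hat r (lt_of_le_of_ne hr0 hrne.symm)
        exact ⟨b, hb, fun a ha => inf_eq_zero_mono (hs a ha).1.le hb.1.le le_rfl hbr (hrs a ha)⟩
    exact ⟨d, fun n => (hd n).1, fun m n hmn => hdis hmn⟩
  · push Not at hat
    obtain ⟨x, hx, h⟩ := hat
    exact exists_disjoint_seq_of_no_atom hx h

end Atoms

/-! ### The equivalence -/

/-- If neither the dual norm of `E` is order continuous nor `F` is finite-dimensional, then `E` maps
onto `ℓ¹` by means of disjoint functionals, and sending the unit vectors of `ℓ¹` to a normalized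
disjoint sequence of `F` yields an operator that is not semi-compact. -/
theorem exists_isAlmostLWeaklyCompact_not_isSemiCompact
    {E : Type u} [NormedAddCommGroup E] [NormedSpace ℝ E] [CompleteSpace E]
    [Lattice E] [IsOrderedAddMonoid E] [IsOrderedModule ℝ E] [HasSolidNorm E]
    {F : Type v} [NormedAddCommGroup F] [NormedSpace ℝ F] [CompleteSpace F]
    [Lattice F] [IsOrderedAddMonoid F] [IsOrderedModule ℝ F] [HasSolidNorm F]
    (hF : HasOrderContinuousNorm F) (hE : ¬ DualHasOrderContinuousNorm E)
    (hFd : ¬ FiniteDimensional ℝ F) :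
    ∃ T : E →L[ℝ] F, (∀ x : E, 0 ≤ x → 0 ≤ T x) ∧ IsAlmostLWeaklyCompact T ∧
      ¬ IsSemiCompact T := by
  obtain ⟨f, hf, s, hs0, hs1, hdis, hlim⟩ : ∃ f : E →L[ℝ] ℝ, (∀ x, 0 ≤ x → 0 ≤ f x) ∧
      ∃ s : ℕ → E, (∀ n, 0 ≤ s n) ∧ (∀ n, ‖s n‖ ≤ 1) ∧ (∀ m n, m ≠ n → s m ⊓ s n = 0) ∧
        ¬ Tendsto (fun n => f (s n)) atTop (𝓝 0) := by
    by_contra! hcon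
    exact hE (dualHasOrderContinuousNorm_of_forall_disjoint hcon)
  obtain ⟨δ, hδ, ψ, hψ, hψδ⟩ :=
    exists_strictMono_forall_le_of_not_tendsto_zero (fun n => hf _ (hs0 n)) hlim
  obtain ⟨φ, hφ0, hφf, hφs, hφd⟩ := exists_disjoint_components f hf (s := s ∘ ψ)
    (fun n => hs0 _) fun m n hmn => hdis _ _ (hψ.injective.ne hmn)
  obtain ⟨d, hd0, hddis⟩ := exists_disjoint_seq_of_not_finiteDimensional hFd
  let y : ℕ → F := fun n => ‖d n‖⁻¹ • d n
  have hy0 : ∀ n, 0 ≤ y n := fun n => smul_nonneg (by positivity) (hd0 n).le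
  have hy1 : ∀ n, ‖y n‖ = 1 := fun n => by
    rw [norm_smul, norm_inv, norm_norm, inv_mul_cancel₀ (norm_ne_zero_iff.2 (hd0 n).ne')]
  have hφsum := sum_abs_le_of_sum_le hφ0 hφf
  obtain ⟨T, hT⟩ := exists_clm_hasSum hφsum fun n => (hy1 n).le
  refine ⟨T, fun x hx => (hT x).nonneg fun n => smul_nonneg (hφ0 n x hx) (hy0 n),
    hF.isAlmostLWeaklyCompact_of_hasSum hφsum hy0 (fun n => (hy1 n).le) hT, fun hsc => ?_⟩
  have hTs : ∀ n, T (s (ψ n)) = f (s (ψ n)) • y n := fun n => by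
    refine (hT _).unique ?_
    have := hasSum_single (f := fun m => φ m (s (ψ n)) • y m) n fun m hm => by
      have := hφd n m hm.symm
      simp only [Function.comp] at this
      rw [this, zero_smul]
    have h2 := hφs n
    simp only [Function.comp] at h2
    rwa [h2] at this
  -- The image of the unit ball would be L-weakly compact, but `δ • y n` is in its solid hull.
  have hL : IsLWeaklyCompact (T '' {x | ‖x‖ ≤ 1}) := hF.isLWeaklyCompact fun ε hε => by
    obtain ⟨u, hu0, hu⟩ := (isSemiCompact_iff T).1 hsc ε hε
    exact ⟨u, hu0, by rintro _ ⟨x, hx, rfl⟩; exact hu x hx⟩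
  have hδy : ∀ n, 0 ≤ δ • y n := fun n => smul_nonneg hδ.le (hy0 n)
  have hnull := hL.2 (fun n => δ • y n)
    (fun n => ⟨_, ⟨s (ψ n), hs1 _, rfl⟩, by
      rw [abs_of_nonneg (hδy n), hTs,
        abs_of_nonneg (smul_nonneg (hf _ (hs0 _)) (hy0 n))]
      exact smul_le_smul_of_nonneg_right (hψδ n) (hy0 n)⟩)
    (fun m n hmn => by
      rw [abs_of_nonneg (hδy m), abs_of_nonneg (hδy n), smul_smul, smul_smul]
      exact smul_inf_smul_eq_zero (hd0 m).le (hd0 n).le (hddis m n hmn) (by positivity)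
        (by positivity))
  simp only [norm_smul, hy1, mul_one, Real.norm_of_nonneg hδ.le] at hnull
  exact hδ.ne' (tendsto_nhds_unique tendsto_const_nhds hnull)

theorem theorem4
    {E : Type u} [NormedAddCommGroup E] [NormedSpace ℝ E] [CompleteSpace E]
    [Lattice E] [IsOrderedAddMonoid E] [IsOrderedModule ℝ E] [HasSolidNorm E]
    {F : Type v} [NormedAddCommGroup F] [NormedSpace ℝ F] [CompleteSpace F]
    [Lattice F] [IsOrderedAddMonoid F] [IsOrderedModule ℝ F] [HasSolidNorm F]
    (hF : HasOrderContinuousNorm F) :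
    (∀ T : E →L[ℝ] F, (∀ x : E, 0 ≤ x → 0 ≤ T x) → IsAlmostLWeaklyCompact T → IsSemiCompact T) ↔
      (DualHasOrderContinuousNorm E ∨ FiniteDimensional ℝ E ∨ FiniteDimensional ℝ F) := by
  constructor
  · intro h
    by_contra! hcon
    obtain ⟨T, hT, hTL, hTs⟩ :=
      exists_isAlmostLWeaklyCompact_not_isSemiCompact hF hcon.1 hcon.2.2
    exact hTs (h T hT hTL)
  · rintro (hE | hE | hFd) T hT hTL
    · exact hTL.isSemiCompact hE hF hT
    · exact isSemiCompact_of_finiteDimensional_domain T hT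
    · exact isSemiCompact_of_finiteDimensional_codomain T
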